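/- **Setting.** Let $\mathbf{Set}^{\omega^{\mathrm{op}}}$ be the topos of trees: an object $X$ is a family of sets $(X_n)_{n\in\omega}$ with restriction maps $X_{n}\to X_m$ ($m\le n$). Products and coproducts are stagewise, $(Y^X)_n$ is the set of tuples $(f_i\colon X_i\to Y_i)_{i\le n}$ commuting with restrictions, $\mathcal P_\omega$ is the stagewise finite powerset functor, and $\triangleright$ is the later modality, $\triangleright_0X=1$, $\triangleright_{n+1}X=X_n$. *Syntax.* Programs of xNCCL are the closed terms of the grammar $p,q ::= S\mid K\mid I\mid S'(p)\mid K'(p)\mid S''(p,q)\mid p\,q\mid p\oplus q\mid p\parallel q$. Let $\Sigma$ be the corresponding polynomial functor, taken stagewise on $\mathbf{Set}^{\omega^{\mathrm{op}}}$; $\Sigma^\star X$ is the object of terms with variables in $X$ (stagewise), $\hat a\colon\Sigma^\star A\to A$ is term evaluation in a $\Sigma$-algebra $(A,a)$, and the initial algebra $(\mu\Sigma,\iota)$ is the constant presheaf of programs. Write $[\![-]\!]\colon\mu\Sigma\to A$ for the unique $\Sigma$-algebra morphism. *Rules.* The transitions $p\to p'$ and $p\xrightarrow{t}p'$ are generated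 by $S\xrightarrow{t}S'(t)$, $S'(p)\xrightarrow{t}S''(p,t)$, $S''(p,q)\xrightarrow{t}(p\,t)(q\,t)$, $K\xrightarrow{t}K'(t)$, $K'(p)\xrightarrow{t}p$, $I\xrightarrow{t}t$; if $p\to p'$ then $p\,q\to p'\,q$; if $p\xrightarrow{q}p'$ then $p\,q\to p'$; $p\oplus q\to p$ and $p\oplus q\to q$; if $p\to p'$ and $q\to q'$ then $p\parallel q\to p'\parallel q'$; if $p\xrightarrow{r}p'$ and $q\to q'$ then $p\parallel q\to p\parallel q'$; if $p\to p'$ and $q\xrightarrow{r}q'$ then $p\parallel q\to p'\parallel q$; if $p\xrightarrow{r}p'$ and $q\xrightarrow{s}q'$ then $p\parallel q\xrightarrow{t}p\,t\parallel q\,t$ for all $t$. *Behaviour.* Let $B(X,Y)=\mathcal P_\omega(\triangleright Y)+(\triangleright Y)^{\triangleright X}$. A higher-order coalgebra $z\colon Z\to B(Z,Z)$ is *locally final* if it is a final coalgebra of the endofunctor $B(Z,-)$. The rules are encoded by a higher-order GSOS law $\rho_{X,Y}\colon\Sigma(X\times B(X,Y))\to B(X,\Sigma^\star(X+Y))$,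 dinatural in $X$ and natural in $Y$. Here an argument $(p,b)\in X_n\times B_n(X,Y)$ of an operator is a formal program $p$, where $b=U\in\mathcal P_\omega(\triangleright_nY)$ lists its reducts and $b=f\in((\triangleright Y)^{\triangleright X})_n$ is its behaviour as a function. With all elements of $X_n$ restricted to the stage at which they are used, and every term read as the point $*$ at stage $0$ of $\triangleright$: $S,K,I,S'(p),K'(p),S''(p,q)$ are sent to the functions of $t$ given by the six rules for them; $(p,U)\,(q,\_)\mapsto\{p'\,q\mid p'\in U\}$; $(p,f)\,(q,\_)\mapsto\{f_n(q)\}$; $(p,\_)\oplus(q,\_)\mapsto\{p,q\}$; $(p,U)\parallel(q,V)\mapsto\{p'\parallel q'\mid p'\in U,q'\in V\}$; $(p,f)\parallel(q,V)\mapsto\{p\parallel q'\mid q'\in V\}$; $(p,U)\parallel(q,g)\mapsto\{p'\parallel q\mid p'\in U\}$; $(p,f)\parallel(q,g)\mapsto(t\mapsto p\,t\parallel q\,t)$. A *$\rho$-bialgebra* $(X,a\colon\Sigma X\to X,c\colon X\to B(X,X))$ satisfies $c\cdot a=B(\mathrm{id},\hat a\cdot\Sigma^\star\nabla)\cdot\rho_{X,X}\cdot\Sigma\langle\mathrm{id},c\rangle$.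 The *operational model* is the unique $\gamma\colon\mu\Sigma\to B(\mu\Sigma,\mu\Sigma)$ making $(\mu\Sigma,\iota,\gamma)$ a $\rho$-bialgebra. A *denotational model* is a $\rho$-bialgebra whose higher-order coalgebra is locally final. Let $\mathsf{beh}\colon(\mu\Sigma,\gamma)\to\nu B(\mu\Sigma,-)$ be the unique coalgebra morphism into the final $B(\mu\Sigma,-)$-coalgebra. A $\Sigma$-algebra $(A,a)$ is *adequate* if $\mathsf{beh}=e\cdot[\![-]\!]$ for some $e\colon A\to\nu B(\mu\Sigma,-)$. *Bisimilarity.* Step-indexed strong applicative bisimilarity is behavioural equivalence: $p$ and $q$ are equivalent at stage $n$ if $\mathsf{beh}_n(p)=\mathsf{beh}_n(q)$. In relational form, let $(\sim_n)_{n\in\omega}$ be the greatest family of equivalence relations on programs such that $p\sim_{n+1}q$ implies: $p\sim_nq$; if $p\to p'$ then $q\to q'$ for some $q'$ with $p'\sim_nq'$; if $p\xrightarrow{t}p'$ then $q\xrightarrow{t}q'$ for some $q'$ with $p'\sim_nq'$. **Theorem (Denotational model for xNCCL).** 1. $B$ has a locally final coalgebra; moreover $B(X,-)$ has a final coalgebra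 for every $X$. 2. Every locally final coalgebra $(Z,z)$ of $B$ extends to a denotational model $\Sigma Z\xrightarrow{a}Z\xrightarrow{z}B(Z,Z)$ of $\rho$. 3. Every denotational model $(Z,a,z)$ is adequate, and for all programs $p,q$ and all $n\in\omega$, $[\![p]\!]_n=[\![q]\!]_n$ implies $\mathsf{beh}_n(p)=\mathsf{beh}_n(q)$ and $p\sim_nq$. 4. For all programs $p,q$ and $n\in\omega$: $\mathsf{beh}_n(p)=\mathsf{beh}_n(q)$ if and only if $p\sim_{n+1}q$. -/

import Mathlib

open CategoryTheory CategoryTheory.Limits Opposite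

namespace XNCCL

/-! ## Higher-order coalgebras -/

section HigherOrderCoalgebras

universe v u

/-- A higher-order coalgebra `z : Z ⟶ B(Z, Z)` of a mixed-variance bifunctor is *locally final*
if it is a final coalgebra of the endofunctor `B(Z, -)`. -/
def IsLocallyFinal {C : Type u} [Category.{v} C] (B : Cᵒᵖ ⥤ C ⥤ C) (Z : C)
    (z : Z ⟶ (B.obj (op Z)).obj Z) : Prop :=
  Nonempty (IsTerminal (⟨Z, z⟩ : Endofunctor.Coalgebra (B.obj (op Z))))

end HigherOrderCoalgebras

/-! ## The topos of trees -/

/-- The topos of trees: presheaves on the poset `ω = {0 < 1 < 2 < ...}`. -/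
abbrev Tree := ℕᵒᵖ ⥤ Type

/-- The restriction map `X_n → X_m` for `m ≤ n`. -/
def res (X : Tree) {m n : ℕ} (h : m ≤ n) (x : X.obj (op n)) : X.obj (op m) :=
  X.map (homOfLE h).op x

theorem res_self (X : Tree) {n : ℕ} (h : n ≤ n) (x : X.obj (op n)) : res X h x = x := by
  simp [res]

theorem res_res (X : Tree) {k m n : ℕ} (h : k ≤ m) (h' : m ≤ n) (x : X.obj (op n)) :
    res X h (res X h' x) = res X (h.trans h') x := by
  have : (homOfLE (h.trans h')).op = (homOfLE h').op ≫ (homOfLE h).op := rfl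
  simp [res, this]

theorem app_res {X Y : Tree} (f : X ⟶ Y) {m n : ℕ} (h : m ≤ n) (x : X.obj (op n)) :
    f.app (op m) (res X h x) = res Y h (f.app (op n) x) :=
  NatTrans.naturality_apply f (homOfLE h).op x

theorem map_eq_res (X : Tree) {a b : ℕᵒᵖ} (f : a ⟶ b) (x : X.obj a) :
    X.map f x = res X (leOfHom f.unop) x := rfl

/-- A tree given by its stages and restriction maps. -/
abbrev mkTree (o : ℕ → Type) (r : ∀ {m n : ℕ}, m ≤ n → o n → o m)
    (r_self : ∀ {n : ℕ} (x : o n), r (le_refl n) x = x)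
    (r_trans : ∀ {k m n : ℕ} (h : k ≤ m) (h' : m ≤ n) (x : o n),
      r h (r h' x) = r (h.trans h') x) : Tree where
  obj a := o a.unop
  map f := ↾(r (leOfHom f.unop))
  map_id _ := by ext x; exact r_self x
  map_comp f g := by
    ext x; exact (r_trans (leOfHom g.unop) (leOfHom f.unop) x).symm

/-- A morphism of trees given by maps that commute with restriction. -/
abbrev mkHom {X Y : Tree} (f : ∀ n, X.obj (op n) → Y.obj (op n))
    (nat : ∀ {m n : ℕ} (h : m ≤ n) (x : X.obj (op n)), f m (res X h x) = res Y h (f n x)) :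
    X ⟶ Y where
  app a := ↾(f a.unop)
  naturality a b g := by
    ext x; exact nat (leOfHom g.unop) x

theorem hom_ext {X Y : Tree} {f g : X ⟶ Y}
    (h : ∀ n (x : X.obj (op n)), f.app (op n) x = g.app (op n) x) : f = g := by
  ext a x; exact h a.unop x

/-- The binary product of trees (computed stagewise). -/
abbrev prodT (X Y : Tree) : Tree := FunctorToTypes.prod X Y

/-- The binary coproduct of trees (computed stagewise). -/
abbrev sumT (X Y : Tree) : Tree := FunctorToTypes.coprod X Y

/-- `f × g` for morphisms of trees. -/
def prodMap {X X' Y Y' : Tree} (f : X ⟶ X') (g : Y ⟶ Y') : prodT X Y ⟶ prodT X' Y' :=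
  FunctorToTypes.prod.lift (FunctorToTypes.prod.fst ≫ f) (FunctorToTypes.prod.snd ≫ g)

/-- `f + g` for morphisms of trees. -/
def sumMap {X X' Y Y' : Tree} (f : X ⟶ X') (g : Y ⟶ Y') : sumT X Y ⟶ sumT X' Y' :=
  FunctorToTypes.coprod.desc (f ≫ FunctorToTypes.coprod.inl) (g ≫ FunctorToTypes.coprod.inr)

/-- The codiagonal `∇ : X + X ⟶ X`. -/
def codiag (X : Tree) : sumT X X ⟶ X := FunctorToTypes.coprod.desc (𝟙 X) (𝟙 X)

/-! ### The later modality -/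

/-- The stages of `▷X`: the one-point set at stage `0` and `X_n` at stage `n + 1`. -/
def LaterObj (X : Tree) : ℕ → Type
  | 0 => PUnit
  | n + 1 => X.obj (op n)

instance (X : Tree) : Subsingleton (LaterObj X 0) := inferInstanceAs (Subsingleton PUnit)

/-- The restriction maps of `▷X`. -/
def laterRes (X : Tree) : ∀ {m n : ℕ}, m ≤ n → LaterObj X n → LaterObj X m
  | 0, _, _, _ => PUnit.unit
  | _ + 1, _ + 1, h, x => res X (Nat.le_of_succ_le_succ h) x

/-- The action of the later modality on morphisms, at each stage. -/
def laterApp {X Y : Tree} (f : X ⟶ Y) : ∀ n : ℕ, LaterObj X n → LaterObj Y n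
  | 0, _ => PUnit.unit
  | n + 1, x => f.app (op n) x

/-- The later modality `▷` on the topos of trees. -/
def later : Tree ⥤ Tree where
  obj X := mkTree (LaterObj X) (laterRes X)
    (by
      rintro (_ | n) x
      · rfl
      · exact res_self X _ x)
    (by
      rintro (_ | k) (_ | m) (_ | n) h h' x
      · rfl
      · rfl
      · rfl
      · rfl
      · omega
      · omega
      · omega
      · exact res_res X _ _ x)
  map f := mkHom (laterApp f) (by
    rintro (_ | m) (_ | n) h x
    · rfl
    · rfl
    · omega
    · exact app_res f _ x)
  map_id X := hom_ext (by rintro (_ | n) x <;> rfl)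
  map_comp f g := hom_ext (by rintro (_ | n) x <;> rfl)

/-- The canonical map `X_n → ▷_n X`, given by restriction. -/
def next (X : Tree) : ∀ n : ℕ, X.obj (op n) → LaterObj X n
  | 0, _ => PUnit.unit
  | n + 1, x => res X (Nat.le_succ n) x

/-- Stagewise application of a unary family of maps under the later modality. -/
def later₁ {A C : Tree} (f : ∀ i, A.obj (op i) → C.obj (op i)) :
    ∀ n : ℕ, LaterObj A n → LaterObj C n
  | 0, _ => PUnit.unit
  | i + 1, a => f i a

/-- Stagewise application of a binary family of maps under the later modality. -/
def later₂ {A B C : Tree} (f : ∀ i, A.obj (op i) → B.obj (op i) → C.obj (op i)) :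
    ∀ n : ℕ, LaterObj A n → LaterObj B n → LaterObj C n
  | 0, _, _ => PUnit.unit
  | i + 1, a, b => f i a b

/-! ### Exponentials -/

/-- Stage `n` of the exponential `Y^X`: tuples `(f_i : X_i → Y_i)_{i ≤ n}` of maps that commute
with restriction. -/
@[ext]
structure Exp (X Y : Tree) (n : ℕ) where
  app : ∀ i, i ≤ n → X.obj (op i) → Y.obj (op i)
  nat : ∀ {i j : ℕ} (hji : j ≤ i) (hi : i ≤ n) (x : X.obj (op i)),
    res Y hji (app i hi x) = app j (hji.trans hi) (res X hji x)

/-- Restriction of tuples `(f_i)_{i ≤ n}` to `(f_i)_{i ≤ m}`. -/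
def Exp.restrict {X Y : Tree} {m n : ℕ} (h : m ≤ n) (f : Exp X Y n) : Exp X Y m where
  app i hi := f.app i (hi.trans h)
  nat hji hi x := f.nat hji (hi.trans h) x

/-- The functorial action of exponentials, contravariant in the exponent. -/
def Exp.map {X X' Y Y' : Tree} (a : X' ⟶ X) (b : Y ⟶ Y') {n : ℕ} (f : Exp X Y n) :
    Exp X' Y' n where
  app i hi x := b.app (op i) (f.app i hi (a.app (op i) x))
  nat hji hi x := by rw [← app_res, f.nat, app_res]

/-- The exponential bifunctor `(X, Y) ↦ Y^X` on the topos of trees. -/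
def expF : Treeᵒᵖ ⥤ Tree ⥤ Tree where
  obj X :=
    { obj := fun Y => mkTree (Exp X.unop Y) Exp.restrict (fun _ => rfl) (fun _ _ _ => rfl)
      map := fun g => mkHom (fun _ => Exp.map (𝟙 X.unop) g) (fun _ _ => rfl)
      map_id := fun _ => hom_ext (fun _ _ => rfl)
      map_comp := fun _ _ => hom_ext (fun _ _ => rfl) }
  map f :=
    { app := fun Y => mkHom (fun _ => Exp.map f.unop (𝟙 Y)) (fun _ _ => rfl)
      naturality := fun _ _ _ => hom_ext (fun _ _ => rfl) }
  map_id _ := by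
    ext Y : 2
    exact hom_ext (fun _ _ => rfl)
  map_comp _ _ := by
    ext Y : 2
    exact hom_ext (fun _ _ => rfl)

/-! ### Finite powersets -/

/-- The set of finite subsets of `α`. -/
abbrev Pow (α : Type) : Type := {s : Set α // s.Finite}

/-- Direct images of finite subsets. -/
def Pow.map {α β : Type} (f : α → β) (U : Pow α) : Pow β := ⟨f '' U.1, U.2.image f⟩

/-- Direct images of pairs of finite subsets under a binary map. -/
def Pow.map₂ {α β γ : Type} (f : α → β → γ) (U : Pow α) (V : Pow β) : Pow γ :=
  ⟨Set.image2 f U.1 V.1, U.2.image2 f V.2⟩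

/-- The subset `{a, b}`. -/
def Pow.pair {α : Type} (a b : α) : Pow α := ⟨{a, b}, Set.toFinite _⟩

/-- The subset `{a}`. -/
def Pow.single {α : Type} (a : α) : Pow α := ⟨{a}, Set.toFinite _⟩

theorem Pow.map_single {α β : Type} (f : α → β) (a : α) :
    Pow.map f (Pow.single a) = Pow.single (f a) :=
  Subtype.ext Set.image_singleton

theorem Pow.map_square {α β β' γ : Type} {f : α → β} {g : β → γ} {f' : α → β'} {g' : β' → γ}
    (h : ∀ a, g (f a) = g' (f' a)) (U : Pow α) :
    Pow.map g (Pow.map f U) = Pow.map g' (Pow.map f' U) :=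
  Subtype.ext (by
    change g '' (f '' U.1) = g' '' (f' '' U.1)
    rw [Set.image_image, Set.image_image]
    exact Set.image_congr fun a _ => h a)

theorem Pow.map_pair {α β : Type} (f : α → β) (a b : α) :
    Pow.map f (Pow.pair a b) = Pow.pair (f a) (f b) :=
  Subtype.ext (Set.image_pair f a b)

theorem Pow.map₂_square {α α' β β' γ γ' : Type} {f : α → β → γ} {g : γ → γ'}
    {f' : α' → β' → γ'} {a : α → α'} {b : β → β'} (h : ∀ u v, f' (a u) (b v) = g (f u v))
    (U : Pow α) (V : Pow β) :
    Pow.map₂ f' (Pow.map a U) (Pow.map b V) = Pow.map g (Pow.map₂ f U V) :=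
  Subtype.ext (by
    change Set.image2 f' (a '' U.1) (b '' V.1) = g '' Set.image2 f U.1 V.1
    rw [Set.image2_image_left, Set.image2_image_right, Set.image_image2]
    exact Set.image2_congr fun u _ v _ => h u v)

theorem Pow.map_triangle {α β γ : Type} {f : α → β} {g : β → γ} {g' : α → γ}
    (h : ∀ a, g (f a) = g' a) (U : Pow α) : Pow.map g (Pow.map f U) = Pow.map g' U :=
  Subtype.ext (by
    change g '' (f '' U.1) = g' '' U.1
    rw [Set.image_image]
    exact Set.image_congr fun a _ => h a)

theorem Pow.map₂_triangle {α β γ γ' : Type} {f : α → β → γ} {g : γ → γ'} {f' : α → β → γ'}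
    (h : ∀ u v, g (f u v) = f' u v) (U : Pow α) (V : Pow β) :
    Pow.map g (Pow.map₂ f U V) = Pow.map₂ f' U V :=
  Subtype.ext (by
    change g '' Set.image2 f U.1 V.1 = Set.image2 f' U.1 V.1
    rw [Set.image_image2]
    exact Set.image2_congr fun u _ v _ => h u v)

/-- The finite powerset functor on sets. -/
def powType : Type ⥤ Type where
  obj := Pow
  map f := ↾(Pow.map f)
  map_id α := by
    refine ConcreteCategory.hom_ext _ _ fun U => ?_
    exact Subtype.ext (Set.image_id U.1)
  map_comp f g := by
    refine ConcreteCategory.hom_ext _ _ fun U => ?_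
    exact Subtype.ext (Set.image_comp g f U.1)

/-- The stagewise finite powerset functor on the topos of trees. -/
def powF : Tree ⥤ Tree := (Functor.whiskeringRight ℕᵒᵖ Type Type).obj powType

/-! ### The behaviour bifunctor -/

/-- The behaviour bifunctor `B(X, Y) = 𝒫_ω(▷Y) + (▷Y)^(▷X)` of xNCCL. -/
def Bnc : Treeᵒᵖ ⥤ Tree ⥤ Tree where
  obj X :=
    { obj := fun Y => sumT (powF.obj (later.obj Y))
        ((expF.obj (op (later.obj X.unop))).obj (later.obj Y))
      map := fun g => sumMap (powF.map (later.map g))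
        ((expF.obj (op (later.obj X.unop))).map (later.map g))
      map_id := fun Y => by
        simp only [CategoryTheory.Functor.map_id]
        exact hom_ext (fun n x => by rcases x with x | x <;> rfl)
      map_comp := fun g g' => by
        simp only [Functor.map_comp]
        exact hom_ext (fun n x => by rcases x with x | x <;> rfl) }
  map f :=
    { app := fun Y => sumMap (𝟙 _) ((expF.map (later.map f.unop).op).app (later.obj Y))
      naturality := fun _ _ _ => hom_ext (fun n x => by rcases x with x | x <;> rfl) }
  map_id X := by
    ext Y : 2
    simp only [unop_id, CategoryTheory.Functor.map_id]
    exact hom_ext (fun n x => by rcases x with x | x <;> rfl)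
  map_comp f g := by
    ext Y : 2
    simp only [unop_comp, Functor.map_comp, op_comp]
    exact hom_ext (fun n x => by rcases x with x | x <;> rfl)

/-! ## Syntax -/

/-- The polynomial functor of the signature of xNCCL on sets: constants `S`, `K`, `I`, the auxiliary
operators `S'`, `K'` (unary) and `S''` (binary), written `S₁`, `K₁`, `S₂` here, application,
non-deterministic choice and parallel composition. -/
inductive Sig (X : Type) : Type
  | S : Sig X
  | K : Sig X
  | I : Sig X
  | S₁ (p : X) : Sig X
  | K₁ (p : X) : Sig X
  | S₂ (p q : X) : Sig X
  | app (p q : X) : Sig X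
  | choice (p q : X) : Sig X
  | par (p q : X) : Sig X

/-- Functorial action of the signature. -/
def Sig.map {X Y : Type} (f : X → Y) : Sig X → Sig Y
  | .S => .S
  | .K => .K
  | .I => .I
  | .S₁ p => .S₁ (f p)
  | .K₁ p => .K₁ (f p)
  | .S₂ p q => .S₂ (f p) (f q)
  | .app p q => .app (f p) (f q)
  | .choice p q => .choice (f p) (f q)
  | .par p q => .par (f p) (f q)

/-- The signature as a functor on sets. -/
def sigType : Type ⥤ Type where
  obj := Sig
  map f := ↾(Sig.map f)
  map_id _ := ConcreteCategory.hom_ext _ _ fun s => by cases s <;> rfl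
  map_comp _ _ := ConcreteCategory.hom_ext _ _ fun s => by cases s <;> rfl

/-- The syntax functor `Σ` on the topos of trees, computed stagewise. -/
def sigF : Tree ⥤ Tree := (Functor.whiskeringRight ℕᵒᵖ Type Type).obj sigType

/-- Terms over the signature with variables from `V`. -/
inductive Term (V : Type) : Type
  | var (v : V) : Term V
  | S : Term V
  | K : Term V
  | I : Term V
  | S₁ (p : Term V) : Term V
  | K₁ (p : Term V) : Term V
  | S₂ (p q : Term V) : Term V
  | app (p q : Term V) : Term V
  | choice (p q : Term V) : Term V
  | par (p q : Term V) : Term V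

namespace Term

/-- The structure of the term algebra. -/
def mk {V : Type} : Sig (Term V) → Term V
  | .S => S
  | .K => K
  | .I => I
  | .S₁ p => S₁ p
  | .K₁ p => K₁ p
  | .S₂ p q => S₂ p q
  | .app p q => app p q
  | .choice p q => choice p q
  | .par p q => par p q

/-- The unique extension of `h : V → A` to a homomorphism from the term algebra to `(A, a)`. -/
def fold {V A : Type} (h : V → A) (a : Sig A → A) : Term V → A
  | var v => h v
  | S => a .S
  | K => a .K
  | I => a .I
  | S₁ p => a (.S₁ (p.fold h a))
  | K₁ p => a (.K₁ (p.fold h a))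
  | S₂ p q => a (.S₂ (p.fold h a) (q.fold h a))
  | app p q => a (.app (p.fold h a) (q.fold h a))
  | choice p q => a (.choice (p.fold h a) (q.fold h a))
  | par p q => a (.par (p.fold h a) (q.fold h a))

/-- Renaming of variables. -/
def map {V W : Type} (f : V → W) : Term V → Term W := fold (fun v => var (f v)) mk

theorem fold_mk {V A : Type} (h : V → A) (a : Sig A → A) (s : Sig (Term V)) :
    fold h a (mk s) = a (s.map (fold h a)) := by
  cases s <;> rfl

theorem fold_unique {V A : Type} (h : V → A) (a : Sig A → A) (k : Term V → A)
    (hv : ∀ v, k (var v) = h v) (hm : ∀ s, k (mk s) = a (s.map k)) (t : Term V) :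
    k t = fold h a t := by
  induction t with
  | var v => exact hv v
  | S => exact hm .S
  | K => exact hm .K
  | I => exact hm .I
  | S₁ p ih => exact (hm (.S₁ p)).trans (by simp only [Sig.map, fold, ih])
  | K₁ p ih => exact (hm (.K₁ p)).trans (by simp only [Sig.map, fold, ih])
  | S₂ p q ih ih' => exact (hm (.S₂ p q)).trans (by simp only [Sig.map, fold, ih, ih'])
  | app p q ih ih' => exact (hm (.app p q)).trans (by simp only [Sig.map, fold, ih, ih'])
  | choice p q ih ih' => exact (hm (.choice p q)).trans (by simp only [Sig.map, fold, ih, ih'])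
  | par p q ih ih' => exact (hm (.par p q)).trans (by simp only [Sig.map, fold, ih, ih'])

theorem comp_fold {V A A' : Type} (h : V → A) (a : Sig A → A) (a' : Sig A' → A') (k : A → A')
    (hk : ∀ s, k (a s) = a' (s.map k)) (t : Term V) :
    k (fold h a t) = fold (fun v => k (h v)) a' t := by
  induction t with
  | var v => rfl
  | _ => simp_all [fold, Sig.map]

theorem map_id' {V : Type} (t : Term V) : map (fun v => v) t = t :=
  (fold_unique _ _ (fun t => t) (fun _ => rfl) (fun s => by cases s <;> rfl) t).symm

theorem map_map {U V W : Type} (f : U → V) (g : V → W) (t : Term U) :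
    map g (map f t) = map (fun u => g (f u)) t :=
  comp_fold _ _ _ (map g) (fun s => by cases s <;> rfl) t

end Term

/-- The term functor on sets. -/
def termType : Type ⥤ Type where
  obj := Term
  map f := ↾(Term.map f)
  map_id V := ConcreteCategory.hom_ext (X := (Term V : Type)) _ _ fun (t : Term _) => Term.map_id' t
  map_comp {U _ W} f g := ConcreteCategory.hom_ext (X := (Term U : Type)) (Y := (Term W : Type)) _ _
    fun t => (Term.map_map f g t).symm

/-- The free monad `Σ⋆` on the topos of trees as a functor: at each stage, terms with variables
from that stage. -/
def termF : Tree ⥤ Tree := (Functor.whiskeringRight ℕᵒᵖ Type Type).obj termType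

/-- The evaluation `Σ⋆ A ⟶ A` of terms in a `Σ`-algebra, i.e. the induced Eilenberg-Moore
algebra. -/
def evalT {A : Tree} (a : sigF.obj A ⟶ A) : termF.obj A ⟶ A :=
  mkHom (fun n => Term.fold id (a.app (op n))) (fun {m n} h t => by
    refine Eq.trans (Term.comp_fold (fun v => Term.var (res A h v)) Term.mk (a.app (op m))
      (Term.fold id (a.app (op m))) (fun s => Term.fold_mk _ _ s) t) ?_
    exact (Term.comp_fold id (a.app (op n)) (a.app (op m)) (res A h)
      (fun s => (app_res a h s).symm) t).symm)

/-- Closed terms, i.e. programs. -/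
abbrev Prog : Type := Term Empty

/-- The constant presheaf of closed terms, as a `Σ`-algebra `ι : Σ(μΣ) ⟶ μΣ`. -/
def muSig : Endofunctor.Algebra sigF where
  a := (Functor.const ℕᵒᵖ).obj Prog
  str := mkHom (fun _ => Term.mk) (fun _ s => by cases s <;> rfl)

/-- `(μΣ, ι)` is the initial `Σ`-algebra. -/
def muSigInitial : IsInitial muSig :=
  IsInitial.ofUniqueHom
    (fun A =>
      { f := mkHom (fun n => Term.fold Empty.elim (A.str.app (op n))) (fun {m n} h t => by
          refine Eq.trans ?_ (Term.comp_fold Empty.elim (A.str.app (op n)) (A.str.app (op m))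
            (res A.a h) (fun s => (app_res A.str h s).symm) t).symm
          exact congrArg (fun e => Term.fold e (A.str.app (op m)) t) (funext fun e => e.elim))
        h := hom_ext fun n s => (Term.fold_mk _ _ s).symm })
    (fun A g => by
      apply Endofunctor.Algebra.ext
      refine hom_ext fun n t => ?_
      refine Term.fold_unique _ _ (g.f.app (op n)) (fun e => e.elim) (fun s => ?_) t
      exact (ConcreteCategory.congr_hom (NatTrans.congr_app g.h (op n)) s).symm)

/-- The denotation map `⟦-⟧ : μΣ ⟶ A`, i.e. the unique `Σ`-algebra morphism into `(A, a)`. -/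
def sem {A : Tree} (a : sigF.obj A ⟶ A) : muSig.a ⟶ A :=
  (muSigInitial.to ⟨A, a⟩).f

/-- Primitive recursion: the unique `g : μΣ ⟶ P` with `g ∘ ι = s ∘ Σ⟨id, g⟩`. -/
def primRec {P : Tree} (s : sigF.obj (prodT muSig.a P) ⟶ P) : muSig.a ⟶ P :=
  (muSigInitial.to ⟨prodT muSig.a P,
    FunctorToTypes.prod.lift (sigF.map FunctorToTypes.prod.fst ≫ muSig.str) s⟩).f ≫
    FunctorToTypes.prod.snd

theorem primRec_spec {P : Tree} (s : sigF.obj (prodT muSig.a P) ⟶ P) :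
    muSig.str ≫ primRec s =
      sigF.map (FunctorToTypes.prod.lift (𝟙 muSig.a) (primRec s)) ≫ s := by
  obtain ⟨f, h, hf⟩ : ∃ f : muSig.a ⟶ prodT muSig.a P,
      sigF.map f ≫ FunctorToTypes.prod.lift (sigF.map FunctorToTypes.prod.fst ≫ muSig.str) s =
        muSig.str ≫ f ∧ primRec s = f ≫ FunctorToTypes.prod.snd :=
    ⟨_, Endofunctor.Algebra.Hom.h _, rfl⟩
  have h1 : f ≫ FunctorToTypes.prod.fst = 𝟙 muSig.a := by
    let k : muSig ⟶ muSig :=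
      { f := f ≫ FunctorToTypes.prod.fst
        h := by
          rw [Functor.map_comp, Category.assoc, ← Category.assoc muSig.str, ← h]
          rfl }
    exact congrArg Endofunctor.Algebra.Hom.f (muSigInitial.hom_ext k (𝟙 _))
  have h2 : FunctorToTypes.prod.lift (𝟙 muSig.a) (primRec s) = f := by
    rw [← h1, hf]; rfl
  rw [h2, hf, ← Category.assoc, ← h]
  rfl

theorem primRec_unique {P : Tree} (s : sigF.obj (prodT muSig.a P) ⟶ P) (g : muSig.a ⟶ P)
    (hg : muSig.str ≫ g = sigF.map (FunctorToTypes.prod.lift (𝟙 muSig.a) g) ≫ s) :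
    g = primRec s := by
  have e : sigF.map (FunctorToTypes.prod.lift (𝟙 muSig.a) g) ≫
      FunctorToTypes.prod.lift (sigF.map FunctorToTypes.prod.fst ≫ muSig.str) s =
      muSig.str ≫ FunctorToTypes.prod.lift (𝟙 muSig.a) g := by
    have e1 : muSig.str ≫ FunctorToTypes.prod.lift (𝟙 muSig.a) g =
        FunctorToTypes.prod.lift muSig.str (muSig.str ≫ g) := rfl
    have e2 : sigF.map (FunctorToTypes.prod.lift (𝟙 muSig.a) g) ≫
        FunctorToTypes.prod.lift (sigF.map FunctorToTypes.prod.fst ≫ muSig.str) s =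
        FunctorToTypes.prod.lift
          (sigF.map (FunctorToTypes.prod.lift (𝟙 muSig.a) g) ≫
            sigF.map FunctorToTypes.prod.fst ≫ muSig.str)
          (sigF.map (FunctorToTypes.prod.lift (𝟙 muSig.a) g) ≫ s) := rfl
    rw [e1, e2, ← Functor.map_comp_assoc, FunctorToTypes.prod.lift_fst,
      CategoryTheory.Functor.map_id, Category.id_comp, hg]
  let k : muSig ⟶ ⟨prodT muSig.a P,
      FunctorToTypes.prod.lift (sigF.map FunctorToTypes.prod.fst ≫ muSig.str) s⟩ :=
    { f := FunctorToTypes.prod.lift (𝟙 muSig.a) g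
      h := e }
  have hk : FunctorToTypes.prod.lift (𝟙 muSig.a) g = (muSigInitial.to ⟨prodT muSig.a P,
      FunctorToTypes.prod.lift (sigF.map FunctorToTypes.prod.fst ≫ muSig.str) s⟩).f :=
    congrArg Endofunctor.Algebra.Hom.f (muSigInitial.hom_ext k (muSigInitial.to _))
  have e3 : FunctorToTypes.prod.lift (𝟙 muSig.a) g ≫ FunctorToTypes.prod.snd = g := rfl
  exact e3.symm.trans (congrArg (fun f => f ≫ FunctorToTypes.prod.snd) hk)

/-! ## Higher-order GSOS laws and their models -/

/-- A higher-order GSOS law of `Σ` over a bifunctor `B` on the topos of trees: a family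
`ρ_{X,Y} : Σ(X × B(X, Y)) ⟶ B(X, Σ⋆(X + Y))` dinatural in `X` and natural in `Y`. -/
structure HOGSOSLaw (B : Treeᵒᵖ ⥤ Tree ⥤ Tree) where
  app : ∀ X Y : Tree, sigF.obj (prodT X ((B.obj (op X)).obj Y)) ⟶
    (B.obj (op X)).obj (termF.obj (sumT X Y))
  natural : ∀ (X : Tree) {Y Y' : Tree} (g : Y ⟶ Y'),
    sigF.map (prodMap (𝟙 X) ((B.obj (op X)).map g)) ≫ app X Y' =
      app X Y ≫ (B.obj (op X)).map (termF.map (sumMap (𝟙 X) g))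
  dinatural : ∀ {X X' : Tree} (h : X ⟶ X') (Y : Tree),
    sigF.map (prodMap (𝟙 X) ((B.map h.op).app Y)) ≫ app X Y ≫
        (B.obj (op X)).map (termF.map (sumMap h (𝟙 Y))) =
      sigF.map (prodMap h (𝟙 ((B.obj (op X')).obj Y))) ≫ app X' Y ≫
        (B.map h.op).app (termF.obj (sumT X' Y))

namespace HOGSOSLaw

variable {B : Treeᵒᵖ ⥤ Tree ⥤ Tree} (ρ : HOGSOSLaw B)

/-- The composite `B(id, â ∘ Σ⋆∇) ∘ ρ_{X,X} : Σ(X × B(X, X)) ⟶ B(X, X)` for a `Σ`-algebra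
`(X, a)`. -/
def step {X : Tree} (a : sigF.obj X ⟶ X) :
    sigF.obj (prodT X ((B.obj (op X)).obj X)) ⟶ (B.obj (op X)).obj X :=
  ρ.app X X ≫ (B.obj (op X)).map (termF.map (codiag X) ≫ evalT a)

/-- `(X, a, c)` is a `ρ`-bialgebra. -/
def IsBialgebra (X : Tree) (a : sigF.obj X ⟶ X) (c : X ⟶ (B.obj (op X)).obj X) : Prop :=
  a ≫ c = sigF.map (FunctorToTypes.prod.lift (𝟙 X) c) ≫ ρ.step a

/-- A denotational model: a `ρ`-bialgebra whose higher-order coalgebra is locally final. -/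
def IsDenotationalModel (Z : Tree) (a : sigF.obj Z ⟶ Z) (z : Z ⟶ (B.obj (op Z)).obj Z) : Prop :=
  ρ.IsBialgebra Z a z ∧ IsLocallyFinal B Z z

/-- The operational model `γ : μΣ ⟶ B(μΣ, μΣ)` of `ρ`, defined by primitive recursion. -/
def opModel : muSig.a ⟶ (B.obj (op muSig.a)).obj muSig.a :=
  primRec (ρ.step muSig.str)

/-- The operational model satisfies its defining diagram. -/
theorem opModel_isBialgebra : ρ.IsBialgebra muSig.a muSig.str ρ.opModel :=
  primRec_spec _

/-- The defining diagram determines the operational model. -/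
theorem opModel_unique (c : muSig.a ⟶ (B.obj (op muSig.a)).obj muSig.a)
    (hc : ρ.IsBialgebra muSig.a muSig.str c) : c = ρ.opModel :=
  primRec_unique _ c hc

/-- The operational model as a coalgebra for `B(μΣ, -)`. -/
def opCoalg : Endofunctor.Coalgebra (B.obj (op muSig.a)) := ⟨muSig.a, ρ.opModel⟩

/-- The behaviour map `beh : μΣ ⟶ ν B(μΣ, -)` into a given final `B(μΣ, -)`-coalgebra. -/
def beh {T : Endofunctor.Coalgebra (B.obj (op muSig.a))} (hT : IsTerminal T) : muSig.a ⟶ T.V :=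
  (hT.from ρ.opCoalg).f

/-- A `Σ`-algebra `(A, a)` is adequate if `beh` factorizes through `⟦-⟧ : μΣ ⟶ A`. -/
def IsAdequate (A : Tree) (a : sigF.obj A ⟶ A) : Prop :=
  ∀ (T : Endofunctor.Coalgebra (B.obj (op muSig.a))) (hT : IsTerminal T),
    ∃ e : A ⟶ T.V, sem a ≫ e = ρ.beh hT

/-- Stage-`n` behavioural equivalence of programs with respect to the final
`B(μΣ, -)`-coalgebra. -/
def BehEquiv (n : ℕ) (p q : Prog) : Prop :=
  ∀ (T : Endofunctor.Coalgebra (B.obj (op muSig.a))) (hT : IsTerminal T),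
    (ρ.beh hT).app (op n) p = (ρ.beh hT).app (op n) q

end HOGSOSLaw

/-! ## The higher-order GSOS law of xNCCL -/

section Rho

/-- A variable from `X` as a term over `X + Y`. -/
abbrev tx {A C : Type} (p : A) : Term (A ⊕ C) := .var (.inl p)

/-- A variable from `Y` as a term over `X + Y`. -/
abbrev ty {A C : Type} (p : C) : Term (A ⊕ C) := .var (.inr p)

/-- A tuple of maps `▷_i X → ▷_i C` (`i ≤ n`), given for `i = j + 1` by the map `k j`. -/
def lam {X C : Tree} {n : ℕ} (k : ∀ j, j < n → X.obj (op j) → C.obj (op j))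
    (hk : ∀ {i j : ℕ} (hji : j ≤ i) (hi : i < n) (t : X.obj (op i)),
      res C hji (k i hi t) = k j (lt_of_le_of_lt hji hi) (res X hji t)) :
    Exp (later.obj X) (later.obj C) n where
  app
    | 0, _, _ => PUnit.unit
    | j + 1, hj, t => k j hj t
  nat := by
    rintro (_ | i) (_ | j) hji hi t
    · rfl
    · omega
    · rfl
    · exact hk (Nat.le_of_succ_le_succ hji) hi t

/-- The operational rules of xNCCL, as a map
`Σ(X × B(X, Y))_n → B(X, Σ⋆(X + Y))_n` at each stage `n`. -/
def rhoFun (X Y : Tree) (n : ℕ) :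
    Sig (X.obj (op n) × (Pow (LaterObj Y n) ⊕ Exp (later.obj X) (later.obj Y) n)) →
      Pow (LaterObj (termF.obj (sumT X Y)) n) ⊕
        Exp (later.obj X) (later.obj (termF.obj (sumT X Y))) n
  | .S => .inr (lam (fun _ _ t => .S₁ (tx t)) (fun _ _ _ => rfl))
  | .K => .inr (lam (fun _ _ t => .K₁ (tx t)) (fun _ _ _ => rfl))
  | .I => .inr (lam (fun _ _ t => tx t) (fun _ _ _ => rfl))
  | .S₁ (p, _) => .inr (lam (fun _ h t => .S₂ (tx (res X h.le p)) (tx t))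
      (fun hji hi _ => congrArg (fun p => Term.S₂ (tx p) (tx _)) (res_res X hji hi.le p)))
  | .K₁ (p, _) => .inr (lam (fun _ h _ => tx (res X h.le p))
      (fun hji hi _ => congrArg (fun p => tx p) (res_res X hji hi.le p)))
  | .S₂ (p, _) (q, _) => .inr (lam
      (fun _ h t => .app (.app (tx (res X h.le p)) (tx t)) (.app (tx (res X h.le q)) (tx t)))
      (fun hji hi _ => congrArg₂
        (fun p q => Term.app (.app (tx p) (tx _)) (.app (tx q) (tx _)))
        (res_res X hji hi.le p) (res_res X hji hi.le q)))
  | .app (_, .inl U) (q, _) =>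
      .inl (U.map fun u => later₂ (fun _ u q => Term.app (ty u) (tx q)) n u (next X n q))
  | .app (_, .inr f) (q, _) =>
      .inl (Pow.single (later₁ (fun _ u => ty u) n (f.app n le_rfl (next X n q))))
  | .choice (p, _) (q, _) =>
      .inl (Pow.pair (later₁ (fun _ p => tx p) n (next X n p))
        (later₁ (fun _ q => tx q) n (next X n q)))
  | .par (_, .inl U) (_, .inl V) =>
      .inl (Pow.map₂ (later₂ (fun _ u v => Term.par (ty u) (ty v)) n) U V)
  | .par (p, .inr _) (_, .inl V) =>
      .inl (V.map fun v => later₂ (fun _ p v => Term.par (tx p) (ty v)) n (next X n p) v)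
  | .par (_, .inl U) (q, .inr _) =>
      .inl (U.map fun u => later₂ (fun _ u q => Term.par (ty u) (tx q)) n u (next X n q))
  | .par (p, .inr _) (q, .inr _) => .inr (lam
      (fun _ h t => .par (.app (tx (res X h.le p)) (tx t)) (.app (tx (res X h.le q)) (tx t)))
      (fun hji hi _ => congrArg₂
        (fun p q => Term.par (.app (tx p) (tx _)) (.app (tx q) (tx _)))
        (res_res X hji hi.le p) (res_res X hji hi.le q)))

/-- The law of xNCCL at `X`, `Y`, as a morphism of trees. -/
def rhoHom (X Y : Tree) : sigF.obj (prodT X ((Bnc.obj (op X)).obj Y)) ⟶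
    (Bnc.obj (op X)).obj (termF.obj (sumT X Y)) :=
  mkHom (rhoFun X Y) (by
    intro m n h s
    change rhoFun X Y m (Sig.map (Prod.map (res X h)
        (Sum.map (Pow.map (laterRes Y h)) (Exp.restrict h))) s) =
      Sum.map (Pow.map (laterRes (termF.obj (sumT X Y)) h)) (Exp.restrict h) (rhoFun X Y n s)
    rcases s with _ | _ | _ | ⟨p, b⟩ | ⟨p, b⟩ | ⟨⟨p, b⟩, ⟨q, c⟩⟩ | ⟨⟨p, U | f⟩, ⟨q, c⟩⟩ |
      ⟨⟨p, b⟩, ⟨q, c⟩⟩ | ⟨⟨p, U | f⟩, ⟨q, V | g⟩⟩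
    · refine congrArg Sum.inr (Exp.ext ?_)
      funext i hi t
      cases i <;> rfl
    · refine congrArg Sum.inr (Exp.ext ?_)
      funext i hi t
      cases i <;> rfl
    · refine congrArg Sum.inr (Exp.ext ?_)
      funext i hi t
      cases i <;> rfl
    · refine congrArg Sum.inr (Exp.ext ?_)
      funext i hi t
      rcases i with _ | i
      · rfl
      · exact congrArg (fun p => Term.S₂ (tx p) (tx _)) (res_res X _ h p)
    · refine congrArg Sum.inr (Exp.ext ?_)
      funext i hi t
      rcases i with _ | i
      · rfl
      · exact congrArg (fun p => tx p) (res_res X _ h p)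
    · refine congrArg Sum.inr (Exp.ext ?_)
      funext i hi t
      rcases i with _ | i
      · rfl
      · exact congrArg₂ (fun p q => Term.app (.app (tx p) (tx _)) (.app (tx q) (tx _)))
          (res_res X _ h p) (res_res X _ h q)
    · refine congrArg Sum.inl (Pow.map_square (fun u => ?_) _)
      rcases m with _ | m
      · rfl
      · rcases n with _ | n
        · omega
        · exact congrArg (fun q => Term.app (ty _) (tx q))
            ((res_res X _ h q).trans (res_res X _ _ q).symm)
    · refine congrArg Sum.inl ?_
      rw [Pow.map_single]
      congr 1
      rcases m with _ | m
      · rfl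
      · rcases n with _ | n
        · omega
        · refine congrArg ty (((f.nat h le_rfl (next X (n + 1) q)).trans ?_).symm)
          refine congrArg (f.app (m + 1) h) ?_
          exact (res_res X _ _ q).trans (res_res X _ h q).symm
    · refine congrArg Sum.inl ?_
      rw [Pow.map_pair]
      rcases m with _ | m
      · rfl
      · rcases n with _ | n
        · omega
        · exact congrArg₂ (fun p q => Pow.pair (tx p) (tx q))
            ((res_res X _ h p).trans (res_res X _ _ p).symm)
            ((res_res X _ h q).trans (res_res X _ _ q).symm)
    · refine congrArg Sum.inl (Pow.map₂_square (fun u v => ?_) _ _)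
      rcases m with _ | m
      · rfl
      · rcases n with _ | n
        · omega
        · rfl
    · refine congrArg Sum.inl (Pow.map_square (fun u => ?_) _)
      rcases m with _ | m
      · rfl
      · rcases n with _ | n
        · omega
        · exact congrArg (fun q => Term.par (ty _) (tx q))
            ((res_res X _ h q).trans (res_res X _ _ q).symm)
    · refine congrArg Sum.inl (Pow.map_square (fun u => ?_) _)
      rcases m with _ | m
      · rfl
      · rcases n with _ | n
        · omega
        · exact congrArg (fun q => Term.par (tx q) (ty _))
            ((res_res X _ h p).trans (res_res X _ _ p).symm)
    · refine congrArg Sum.inr (Exp.ext ?_)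
      funext i hi t
      rcases i with _ | i
      · rfl
      · exact congrArg₂ (fun p q => Term.par (.app (tx p) (tx _)) (.app (tx q) (tx _)))
          (res_res X _ h p) (res_res X _ h q))

theorem rho_natural (X : Tree) {Y Y' : Tree} (g : Y ⟶ Y') :
    sigF.map (prodMap (𝟙 X) ((Bnc.obj (op X)).map g)) ≫ rhoHom X Y' =
      rhoHom X Y ≫ (Bnc.obj (op X)).map (termF.map (sumMap (𝟙 X) g)) := by
  refine hom_ext fun n s => ?_
  change rhoFun X Y' n (Sig.map (Prod.map id (Sum.map (Pow.map (laterApp g n))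
      (Exp.map (𝟙 _) (later.map g)))) s) =
    Sum.map (Pow.map (laterApp (termF.map (sumMap (𝟙 X) g)) n))
      (Exp.map (𝟙 _) (later.map (termF.map (sumMap (𝟙 X) g)))) (rhoFun X Y n s)
  rcases s with _ | _ | _ | ⟨p, b⟩ | ⟨p, b⟩ | ⟨⟨p, b⟩, ⟨q, c⟩⟩ | ⟨⟨p, U | f⟩, ⟨q, c⟩⟩ |
    ⟨⟨p, b⟩, ⟨q, c⟩⟩ | ⟨⟨p, U | f⟩, ⟨q, V | k⟩⟩
  · refine congrArg Sum.inr (Exp.ext ?_)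
    funext i hi t
    cases i <;> rfl
  · refine congrArg Sum.inr (Exp.ext ?_)
    funext i hi t
    cases i <;> rfl
  · refine congrArg Sum.inr (Exp.ext ?_)
    funext i hi t
    cases i <;> rfl
  · refine congrArg Sum.inr (Exp.ext ?_)
    funext i hi t
    cases i <;> rfl
  · refine congrArg Sum.inr (Exp.ext ?_)
    funext i hi t
    cases i <;> rfl
  · refine congrArg Sum.inr (Exp.ext ?_)
    funext i hi t
    cases i <;> rfl
  · refine congrArg Sum.inl (Pow.map_square (fun u => ?_) _)
    cases n <;> rfl
  · refine congrArg Sum.inl ?_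
    rw [Pow.map_single]
    cases n <;> rfl
  · refine congrArg Sum.inl ?_
    rw [Pow.map_pair]
    cases n <;> rfl
  · refine congrArg Sum.inl (Pow.map₂_square (fun u v => ?_) _ _)
    cases n <;> rfl
  · refine congrArg Sum.inl (Pow.map_square (fun u => ?_) _)
    cases n <;> rfl
  · refine congrArg Sum.inl (Pow.map_square (fun u => ?_) _)
    cases n <;> rfl
  · refine congrArg Sum.inr (Exp.ext ?_)
    funext i hi t
    cases i <;> rfl

theorem rho_dinatural {X X' : Tree} (h : X ⟶ X') (Y : Tree) :
    sigF.map (prodMap (𝟙 X) ((Bnc.map h.op).app Y)) ≫ rhoHom X Y ≫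
        (Bnc.obj (op X)).map (termF.map (sumMap h (𝟙 Y))) =
      sigF.map (prodMap h (𝟙 ((Bnc.obj (op X')).obj Y))) ≫ rhoHom X' Y ≫
        (Bnc.map h.op).app (termF.obj (sumT X' Y)) := by
  refine hom_ext fun n s => ?_
  change Sum.map (Pow.map (laterApp (termF.map (sumMap h (𝟙 Y))) n))
      (Exp.map (𝟙 _) (later.map (termF.map (sumMap h (𝟙 Y)))))
      (rhoFun X Y n (Sig.map (Prod.map id (Sum.map id (Exp.map (later.map h) (𝟙 _)))) s)) =
    Sum.map id (Exp.map (later.map h) (𝟙 _))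
      (rhoFun X' Y n (Sig.map (Prod.map (h.app (op n)) id) s))
  rcases s with _ | _ | _ | ⟨p, b⟩ | ⟨p, b⟩ | ⟨⟨p, b⟩, ⟨q, c⟩⟩ | ⟨⟨p, U | f⟩, ⟨q, c⟩⟩ |
    ⟨⟨p, b⟩, ⟨q, c⟩⟩ | ⟨⟨p, U | f⟩, ⟨q, V | g⟩⟩
  · refine congrArg Sum.inr (Exp.ext ?_)
    funext i hi t
    cases i <;> rfl
  · refine congrArg Sum.inr (Exp.ext ?_)
    funext i hi t
    cases i <;> rfl
  · refine congrArg Sum.inr (Exp.ext ?_)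
    funext i hi t
    cases i <;> rfl
  · refine congrArg Sum.inr (Exp.ext ?_)
    funext i hi t
    rcases i with _ | i
    · rfl
    · exact congrArg (fun p => Term.S₂ (tx p) (tx _)) (app_res h _ p)
  · refine congrArg Sum.inr (Exp.ext ?_)
    funext i hi t
    rcases i with _ | i
    · rfl
    · exact congrArg (fun p => tx p) (app_res h _ p)
  · refine congrArg Sum.inr (Exp.ext ?_)
    funext i hi t
    rcases i with _ | i
    · rfl
    · exact congrArg₂ (fun p q => Term.app (.app (tx p) (tx _)) (.app (tx q) (tx _)))
        (app_res h _ p) (app_res h _ q)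
  · refine congrArg Sum.inl (Pow.map_triangle (fun u => ?_) _)
    rcases n with _ | n
    · rfl
    · exact congrArg (fun q => Term.app (ty _) (tx q)) (app_res h _ q)
  · refine congrArg Sum.inl ?_
    rw [Pow.map_single]
    rcases n with _ | n
    · rfl
    · exact congrArg (fun q => Pow.single (ty (f.app (n + 1) le_rfl q))) (app_res h _ q)
  · refine congrArg Sum.inl ?_
    rw [Pow.map_pair]
    rcases n with _ | n
    · rfl
    · exact congrArg₂ (fun p q => Pow.pair (tx p) (tx q)) (app_res h _ p) (app_res h _ q)
  · refine congrArg Sum.inl (Pow.map₂_triangle (fun u v => ?_) _ _)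
    cases n <;> rfl
  · refine congrArg Sum.inl (Pow.map_triangle (fun u => ?_) _)
    rcases n with _ | n
    · rfl
    · exact congrArg (fun q => Term.par (ty _) (tx q)) (app_res h _ q)
  · refine congrArg Sum.inl (Pow.map_triangle (fun u => ?_) _)
    rcases n with _ | n
    · rfl
    · exact congrArg (fun p => Term.par (tx p) (ty _)) (app_res h _ p)
  · refine congrArg Sum.inr (Exp.ext ?_)
    funext i hi t
    rcases i with _ | i
    · rfl
    · exact congrArg₂ (fun p q => Term.par (.app (tx p) (tx _)) (.app (tx q) (tx _)))
        (app_res h _ p) (app_res h _ q)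

/-- The higher-order GSOS law of xNCCL. -/
def rhoNc : HOGSOSLaw Bnc where
  app := rhoHom
  natural := rho_natural
  dinatural := rho_dinatural

end Rho

/-! ## Step-indexed strong applicative bisimilarity -/

/-- The labelled transitions: `Lab p t p'` states that `p` acts as a function that maps `t`
to `p'`. -/
inductive Lab : Prog → Prog → Prog → Prop
  | S (t : Prog) : Lab .S t (.S₁ t)
  | S₁ (p t : Prog) : Lab (.S₁ p) t (.S₂ p t)
  | S₂ (p q t : Prog) : Lab (.S₂ p q) t (.app (.app p t) (.app q t))
  | K (t : Prog) : Lab .K t (.K₁ t)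
  | K₁ (p t : Prog) : Lab (.K₁ p) t p
  | I (t : Prog) : Lab .I t t
  | par {p q r s p' q' : Prog} (t : Prog) : Lab p r p' → Lab q s q' →
      Lab (.par p q) t (.par (.app p t) (.app q t))

/-- The unlabelled transitions: `Red p p'` states that `p` reduces to `p'`. -/
inductive Red : Prog → Prog → Prop
  | app_red {p p' : Prog} (q : Prog) : Red p p' → Red (.app p q) (.app p' q)
  | app_lab {p q p' : Prog} : Lab p q p' → Red (.app p q) p'
  | choice_left (p q : Prog) : Red (.choice p q) p
  | choice_right (p q : Prog) : Red (.choice p q) q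
  | par_red {p p' q q' : Prog} : Red p p' → Red q q' → Red (.par p q) (.par p' q')
  | par_right {p p' q q' r : Prog} : Lab p r p' → Red q q' → Red (.par p q) (.par p q')
  | par_left {p p' q q' r : Prog} : Red p p' → Lab q r q' → Red (.par p q) (.par p' q)

/-- An `ω`-indexed family of equivalence relations on programs that is a step-indexed strong
applicative bisimulation. -/
structure IsStepBisim (R : ℕ → Prog → Prog → Prop) : Prop where
  equiv : ∀ n, Equivalence (R n)
  mono : ∀ n p q, R (n + 1) p q → R n p q
  red : ∀ n p q p', R (n + 1) p q → Red p p' → ∃ q', Red q q' ∧ R n p' q'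
  lab : ∀ n p q t p', R (n + 1) p q → Lab p t p' → ∃ q', Lab q t q' ∧ R n p' q'

/-- Step-indexed strong applicative bisimilarity, the greatest step-indexed strong applicative
bisimulation. -/
def StepBisim (n : ℕ) (p q : Prog) : Prop := ∃ R, IsStepBisim R ∧ R n p q

theorem stepBisim_isGreatest : IsGreatest {R | IsStepBisim R} StepBisim := by
  have key : IsStepBisim (fun n => Relation.EqvGen (StepBisim n)) := by
    refine ⟨fun n => Relation.EqvGen.is_equivalence _, ?_, ?_, ?_⟩
    · intro n p q h
      refine Relation.EqvGen.mono ?_ _ _ h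
      rintro p q ⟨R, hR, h⟩
      exact ⟨R, hR, hR.mono n p q h⟩
    · intro n p q p' h
      suffices H : (∀ p', Red p p' → ∃ q', Red q q' ∧ Relation.EqvGen (StepBisim n) p' q') ∧
          (∀ q', Red q q' → ∃ p', Red p p' ∧ Relation.EqvGen (StepBisim n) q' p') from H.1 p'
      induction h with
      | rel p q h =>
        obtain ⟨R, hR, h⟩ := h
        constructor
        · intro p' hp
          obtain ⟨q', hq, hr⟩ := hR.red n p q p' h hp
          exact ⟨q', hq, .rel _ _ ⟨R, hR, hr⟩⟩
        · intro q' hq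
          obtain ⟨p', hp, hr⟩ := hR.red n q p q' ((hR.equiv _).symm h) hq
          exact ⟨p', hp, .rel _ _ ⟨R, hR, hr⟩⟩
      | refl p => exact ⟨fun p' hp => ⟨p', hp, .refl _⟩, fun p' hp => ⟨p', hp, .refl _⟩⟩
      | symm p q _ ih => exact ⟨ih.2, ih.1⟩
      | trans p q r _ _ ih ih' =>
        constructor
        · intro p' hp
          obtain ⟨q', hq, h1⟩ := ih.1 p' hp
          obtain ⟨r', hr, h2⟩ := ih'.1 q' hq
          exact ⟨r', hr, .trans _ _ _ h1 h2⟩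
        · intro r' hr
          obtain ⟨q', hq, h1⟩ := ih'.2 r' hr
          obtain ⟨p', hp, h2⟩ := ih.2 q' hq
          exact ⟨p', hp, .trans _ _ _ h1 h2⟩
    · intro n p q t p' h
      suffices H : (∀ p', Lab p t p' → ∃ q', Lab q t q' ∧ Relation.EqvGen (StepBisim n) p' q') ∧
          (∀ q', Lab q t q' → ∃ p', Lab p t p' ∧ Relation.EqvGen (StepBisim n) q' p') from
        H.1 p'
      induction h with
      | rel p q h =>
        obtain ⟨R, hR, h⟩ := h
        constructor
        · intro p' hp
          obtain ⟨q', hq, hr⟩ := hR.lab n p q t p' h hp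
          exact ⟨q', hq, .rel _ _ ⟨R, hR, hr⟩⟩
        · intro q' hq
          obtain ⟨p', hp, hr⟩ := hR.lab n q p t q' ((hR.equiv _).symm h) hq
          exact ⟨p', hp, .rel _ _ ⟨R, hR, hr⟩⟩
      | refl p => exact ⟨fun p' hp => ⟨p', hp, .refl _⟩, fun p' hp => ⟨p', hp, .refl _⟩⟩
      | symm p q _ ih => exact ⟨ih.2, ih.1⟩
      | trans p q r _ _ ih ih' =>
        constructor
        · intro p' hp
          obtain ⟨q', hq, h1⟩ := ih.1 p' hp
          obtain ⟨r', hr, h2⟩ := ih'.1 q' hq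
          exact ⟨r', hr, .trans _ _ _ h1 h2⟩
        · intro r' hr
          obtain ⟨q', hq, h1⟩ := ih'.2 r' hr
          obtain ⟨p', hp, h2⟩ := ih.2 q' hq
          exact ⟨p', hp, .trans _ _ _ h1 h2⟩
  have e : StepBisim = fun n => Relation.EqvGen (StepBisim n) := by
    funext n p q
    exact propext ⟨fun h => .rel _ _ h, fun h => ⟨_, key, h⟩⟩
  refine ⟨?_, fun R hR n p q h => ⟨R, hR, h⟩⟩
  change IsStepBisim StepBisim
  rw [e]
  exact key

end XNCCL

/-!
A morphism into a tree can be built one stage at a time. The functor `B` uses its arguments only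
under `▷`, so stage `k` of `B` on morphisms depends only on their stages below `k`: `B` is locally
contractive, and recursive equations guarded by `B` have unique solutions. Three instances give the
existence claims. A coalgebra of `B(X, -)` with invertible structure is final, as the morphisms into
it solve a guarded equation. The iterates of `X ↦ B(X, X)` agree on more and more stages and glue to
a `Z ≅ B(Z, Z)`, which is therefore locally final. The bialgebra law is a guarded equation for the
algebra structure on `Z`.

For adequacy, dinaturality of `ρ` makes `B(id, ⟦-⟧) ∘ γ` and `B(⟦-⟧, id) ∘ z ∘ ⟦-⟧` solutions of
the same primitive recursion over `μΣ`. Hence `⟦-⟧` is a coalgebra morphism for `B(μΣ, -)`, and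
composing it with the unique morphism into the final coalgebra gives `beh`.

Finally, the operational model is at each stage the image of one function on programs, whose graph
is the transition relation. Since the structure of the final coalgebra is injective, `beh`
identifies two programs at a stage iff their actions match up to its kernel one stage earlier, and
this recursion also characterizes bisimilarity, shifted by one step.
-/

namespace XNCCL

/-! ## Morphisms defined below a stage -/

section PartialMorphisms

/-- The restriction of trees to the stages `0, …, k - 1`. -/
def stagesBelow (k : ℕ) : Tree ⥤ (Set.Iio k)ᵒᵖ ⥤ Type :=
  (Functor.whiskeringLeft _ _ _).obj (Subtype.mono_coe (· ∈ Set.Iio k)).functor.op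

/-- Morphisms defined at the stages below `k` only, i.e. stage `k` of `▷(Y^X)`. -/
abbrev PartialHom (k : ℕ) (X Y : Tree) : Type := (stagesBelow k).obj X ⟶ (stagesBelow k).obj Y

namespace PartialHom

variable {X Y Z : Tree} {k : ℕ}

/-- The component at stage `n` of a morphism defined below stage `k > n`. -/
def stage (u : PartialHom k X Y) (n : ℕ) (hn : n < k) : X.obj (op n) → Y.obj (op n) :=
  u.app (op ⟨n, hn⟩)

theorem ext {u v : PartialHom k X Y} (h : ∀ n hn x, u.stage n hn x = v.stage n hn x) : u = v :=
  NatTrans.ext <| funext fun a => ConcreteCategory.hom_ext _ _ (h a.unop.1 a.unop.2)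

theorem stage_res (u : PartialHom k X Y) {m n : ℕ} (h : m ≤ n) (hn : n < k) (x : X.obj (op n)) :
    u.stage m (h.trans_lt hn) (res X h x) = res Y h (u.stage n hn x) :=
  NatTrans.naturality_apply u
    (homOfLE (Subtype.mk_le_mk.2 h) : (⟨m, h.trans_lt hn⟩ : Set.Iio k) ⟶ ⟨n, hn⟩).op x

theorem id_stage (n : ℕ) (hn : n < k) (x : X.obj (op n)) :
    stage (𝟙 _ : PartialHom k X X) n hn x = x :=
  rfl

theorem comp_stage (u : PartialHom k X Y) (v : PartialHom k Y Z) (n : ℕ) (hn : n < k)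
    (x : X.obj (op n)) : stage (u ≫ v : PartialHom k X Z) n hn x = v.stage n hn (u.stage n hn x) :=
  rfl

/-- A partial morphism given by maps that commute with restriction. -/
def ofMaps (f : ∀ n, n < k → X.obj (op n) → Y.obj (op n))
    (nat : ∀ {m n : ℕ} (h : m ≤ n) (hn : n < k) (x : X.obj (op n)),
      f m (h.trans_lt hn) (res X h x) = res Y h (f n hn x)) : PartialHom k X Y where
  app a := ↾(f a.unop.1 a.unop.2)
  naturality a _ g := ConcreteCategory.hom_ext _ _ fun x => nat (leOfHom g.unop) a.unop.2 x

instance : Unique (PartialHom 0 X Y) where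
  default := ofMaps (fun _ h => absurd h (Nat.not_lt_zero _))
    (fun _ h => absurd h (Nat.not_lt_zero _))
  uniq _ := PartialHom.ext fun _ h => absurd h (Nat.not_lt_zero _)

end PartialHom

/-- Forgetting the last stage of a tree that is defined below stage `k + 1`. -/
def dropStage (k : ℕ) : ((Set.Iio (k + 1))ᵒᵖ ⥤ Type) ⥤ (Set.Iio k)ᵒᵖ ⥤ Type :=
  (Functor.whiskeringLeft _ _ _).obj
    (Monotone.functor (f := Set.inclusion (Set.Iio_subset_Iio k.le_succ)) fun _ _ h => h).op

variable {X Y : Tree}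

/-- The restriction of a morphism defined below stage `k + 1` to the stages below `k`. -/
def PartialHom.truncate {k : ℕ} (u : PartialHom (k + 1) X Y) : PartialHom k X Y :=
  (dropStage k).map u

theorem PartialHom.truncate_comp {Z : Tree} {k : ℕ} (u : PartialHom (k + 1) X Y)
    (v : PartialHom (k + 1) Y Z) : truncate (u ≫ v) = truncate u ≫ truncate v :=
  (dropStage k).map_comp u v

/-- The restriction of an isomorphism below stage `k + 1` to the stages below `k`. -/
def truncateIso {k : ℕ} (e : (stagesBelow (k + 1)).obj X ≅ (stagesBelow (k + 1)).obj Y) :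
    (stagesBelow k).obj X ≅ (stagesBelow k).obj Y :=
  (dropStage k).mapIso e

theorem truncateIso_trans {Z : Tree} {k : ℕ}
    (e : (stagesBelow (k + 1)).obj X ≅ (stagesBelow (k + 1)).obj Y)
    (e' : (stagesBelow (k + 1)).obj Y ≅ (stagesBelow (k + 1)).obj Z) :
    truncateIso (e ≪≫ e') = truncateIso e ≪≫ truncateIso e' :=
  (dropStage k).mapIso_trans e e'

theorem hom_ext_stagesBelow {f g : X ⟶ Y}
    (h : ∀ k, (stagesBelow (k + 1)).map f = (stagesBelow (k + 1)).map g) : f = g :=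
  hom_ext fun n x => congrArg (PartialHom.stage · n n.lt_succ_self x) (h n)

theorem isIso_of_stagesBelow (f : X ⟶ Y) (h : ∀ k, IsIso ((stagesBelow (k + 1)).map f)) :
    IsIso f := by
  rw [NatTrans.isIso_iff_isIso_app]
  intro a
  exact ((NatTrans.isIso_iff_isIso_app _).1 (h a.unop)) (op ⟨a.unop, a.unop.lt_succ_self⟩)

theorem PartialHom.stage_eq_of_truncate {u : ∀ k, PartialHom (k + 1) X Y}
    (hu : ∀ k, (u (k + 1)).truncate = u k) {n k : ℕ} (h : n ≤ k) (x : X.obj (op n)) :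
    (u k).stage n (Nat.lt_succ_of_le h) x = (u n).stage n n.lt_succ_self x := by
  induction k, h using Nat.le_induction with
  | base => rfl
  | succ k h ih => rw [← ih, ← hu k]; rfl

theorem existsUnique_glue (u : ∀ k, PartialHom (k + 1) X Y)
    (hu : ∀ k, (u (k + 1)).truncate = u k) :
    ∃! f : X ⟶ Y, ∀ k, (stagesBelow (k + 1)).map f = u k := by
  refine ⟨mkHom (fun n => (u n).stage n n.lt_succ_self) fun {m n} h x => ?_, fun k => ?_, ?_⟩
  · rw [← PartialHom.stage_eq_of_truncate hu h]
    exact (u n).stage_res h n.lt_succ_self x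
  · exact PartialHom.ext fun n hn x =>
      (PartialHom.stage_eq_of_truncate hu (Nat.le_of_lt_succ hn) x).symm
  · exact fun g hg => hom_ext_stagesBelow fun k => (hg k).trans (PartialHom.ext fun n hn x =>
      PartialHom.stage_eq_of_truncate hu (Nat.le_of_lt_succ hn) x)

/-- Guarded recursion: if the restriction of `Ψ f` to the stages `≤ k` depends only on that of `f`
to the stages `< k`, then `Ψ` has exactly one fixed point. -/
theorem existsUnique_fixedPoint (Ψ : (X ⟶ Y) → (X ⟶ Y))
    (Φ : ∀ k, PartialHom k X Y → PartialHom (k + 1) X Y)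
    (truncate_Φ : ∀ k u, (Φ (k + 1) u).truncate = Φ k u.truncate)
    (map_Ψ : ∀ k f, (stagesBelow (k + 1)).map (Ψ f) = Φ k ((stagesBelow k).map f)) :
    ∃! f, Ψ f = f := by
  let u : ∀ k, PartialHom k X Y := fun k => Nat.rec default Φ k
  have hu (k) : (u (k + 1)).truncate = u k := by
    induction k with
    | zero => exact Subsingleton.elim _ _
    | succ k ih => exact (truncate_Φ k _).trans (congrArg (Φ k) ih)
  obtain ⟨f, hf, -⟩ := existsUnique_glue (fun k => u (k + 1)) fun k => hu (k + 1)
  have hf' (k) : (stagesBelow k).map f = u k := by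
    rw [← hu, ← hf]; rfl
  refine ⟨f, hom_ext_stagesBelow fun k => ?_, fun g hg => hom_ext_stagesBelow fun k => ?_⟩
  · rw [map_Ψ, hf' k, hf']
  · have hg' (k) : (stagesBelow k).map g = u k := by
      induction k with
      | zero => exact Subsingleton.elim _ _
      | succ k ih => rw [← hg, map_Ψ, ih]
    rw [hf', hg']

end PartialMorphisms

/-! ## Gluing trees -/

theorem PartialHom.isIso_of_bijective {X Y : Tree} {k : ℕ} (u : PartialHom k X Y)
    (h : ∀ n hn, Function.Bijective (u.stage n hn)) : IsIso u := by
  rw [NatTrans.isIso_iff_isIso_app]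
  exact fun a => (isIso_iff_bijective _).2 (h a.unop.1 a.unop.2)

theorem PartialHom.bijective_stage {X Y : Tree} {k : ℕ} (u : PartialHom k X Y) [IsIso u]
    (n : ℕ) (hn : n < k) : Function.Bijective (u.stage n hn) :=
  (isIso_iff_bijective _).1 ((NatTrans.isIso_iff_isIso_app u).1 ‹_› (op ⟨n, hn⟩))

namespace Gluing

variable {X : ℕ → Tree} (c : ∀ k, (stagesBelow k).obj (X k) ≅ (stagesBelow k).obj (X (k + 1)))

/-- The transport of stage `n` of `X k`, `k > n`, to `X (n + 1)` along the inverses of the `c`. -/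
def transport {n k : ℕ} (h : n < k) : (X k).obj (op n) → (X (n + 1)).obj (op n) :=
  Nat.leRec (motive := fun k _ => (X k).obj (op n) → (X (n + 1)).obj (op n)) id
    (fun k h f => f ∘ PartialHom.stage (c k).inv n h) h

theorem transport_self {n : ℕ} (x : (X (n + 1)).obj (op n)) :
    transport c n.lt_succ_self x = x := by
  rw [transport, Nat.leRec_self, id]

theorem transport_succ {n k : ℕ} (h : n < k) :
    transport c (h.trans k.lt_succ_self) = transport c h ∘ PartialHom.stage (c k).inv n h :=
  Nat.leRec_succ _ _ h

theorem transport_hom {n k : ℕ} (h : n < k) (x : (X k).obj (op n)) :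
    transport c (h.trans k.lt_succ_self) (PartialHom.stage (c k).hom n h x) = transport c h x := by
  rw [transport_succ, Function.comp_apply, ← PartialHom.comp_stage, (c k).hom_inv_id,
    PartialHom.id_stage]

theorem bijective_transport {n k : ℕ} (h : n < k) : Function.Bijective (transport c h) := by
  induction k, h using Nat.le_induction with
  | base => convert Function.bijective_id using 1; exact funext (transport_self c)
  | succ k h ih =>
    rw [transport_succ c h]
    exact ih.comp (PartialHom.bijective_stage _ n h)

theorem transport_res {m n k : ℕ} (hmn : m ≤ n) (h : n < k) (x : (X k).obj (op n)) :
    transport c (hmn.trans_lt h) (res (X k) hmn x) =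
      transport c (Nat.lt_succ_of_le hmn) (res (X (n + 1)) hmn (transport c h x)) := by
  induction k, h using Nat.le_induction with
  | base => rw [transport_self]
  | succ k h ih =>
    obtain ⟨x, rfl⟩ := (PartialHom.bijective_stage (c k).hom n h).surjective x
    rw [← PartialHom.stage_res (c k).hom hmn h, transport_hom, transport_hom, ih]

/-- The tree glued from trees `X k`, of which only the stages below `k` matter, along isomorphisms
`c k` below stage `k`: its stage `n` is that of `X (n + 1)`. -/
def glue : Tree :=
  mkTree (fun n => (X (n + 1)).obj (op n))
    (fun {_ n} h x => transport c (Nat.lt_succ_of_le h) (res (X (n + 1)) h x))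
    (fun x => by rw [res_self, transport_self])
    (fun {_ _ n} h h' x => by rw [← transport_res, res_res])

theorem exists_iso_glue :
    ∃ d : ∀ k, (stagesBelow k).obj (X k) ≅ (stagesBelow k).obj (glue c),
      ∀ k, c k ≪≫ truncateIso (d (k + 1)) = d k := by
  let d (k : ℕ) : PartialHom k (X k) (glue c) :=
    .ofMaps (fun n h => transport c h) fun h hn x => transport_res c h hn x
  have hd (k : ℕ) : IsIso (d k) := (d k).isIso_of_bijective fun n h => bijective_transport c h
  exact ⟨fun k => asIso (d k), fun k => Iso.ext <|
    PartialHom.ext (u := (c k).hom ≫ (d (k + 1)).truncate) (v := d k)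
      fun n h x => transport_hom c h x⟩

end Gluing

/-! ## Locally contractive bifunctors -/

/-- Local contractiveness of a mixed-variance bifunctor, as in synthetic guarded domain theory: the
action on morphisms factors through `next`. With stage `k` of `▷(Y^X)` written as
`PartialHom k X Y`, the factorization takes morphisms defined below stage `k` to one defined below
stage `k + 1`. -/
structure LocalContraction (B : Treeᵒᵖ ⥤ Tree ⥤ Tree) where
  map {X X' Y Y' : Tree} {k : ℕ} : PartialHom k X' X → PartialHom k Y Y' →
    PartialHom (k + 1) ((B.obj (op X)).obj Y) ((B.obj (op X')).obj Y')
  map_comp {X X' X'' Y Y' Y'' : Tree} {k : ℕ} (u : PartialHom k X' X) (u' : PartialHom k X'' X')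
    (v : PartialHom k Y Y') (v' : PartialHom k Y' Y'') :
    map (u' ≫ u) (v ≫ v') = map u v ≫ map u' v'
  map_truncate {X X' Y Y' : Tree} {k : ℕ} (u : PartialHom (k + 1) X' X)
    (v : PartialHom (k + 1) Y Y') : (map u v).truncate = map u.truncate v.truncate
  map_stagesBelow {X X' Y Y' : Tree} (k : ℕ) (f : X' ⟶ X) (g : Y ⟶ Y') :
    map ((stagesBelow k).map f) ((stagesBelow k).map g) =
      (stagesBelow (k + 1)).map ((B.map f.op).app Y ≫ (B.obj (op X')).map g)

namespace LocalContraction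

variable {B : Treeᵒᵖ ⥤ Tree ⥤ Tree} (F : LocalContraction B)

theorem map_id (X Y : Tree) (k : ℕ) :
    F.map (𝟙 ((stagesBelow k).obj X)) (𝟙 ((stagesBelow k).obj Y)) = 𝟙 _ := by
  simpa using F.map_stagesBelow k (𝟙 X) (𝟙 Y)

/-- The action of a locally contractive bifunctor on the diagonal. -/
def diagIso {X Y : Tree} {k : ℕ} (e : (stagesBelow k).obj X ≅ (stagesBelow k).obj Y) :
    (stagesBelow (k + 1)).obj ((B.obj (op X)).obj X) ≅
      (stagesBelow (k + 1)).obj ((B.obj (op Y)).obj Y) where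
  hom := F.map e.inv e.hom
  inv := F.map e.hom e.inv
  hom_inv_id := by rw [← F.map_comp, e.hom_inv_id, F.map_id]
  inv_hom_id := by rw [← F.map_comp, e.inv_hom_id, F.map_id]

theorem diagIso_trans {X Y Z : Tree} {k : ℕ} (e : (stagesBelow k).obj X ≅ (stagesBelow k).obj Y)
    (e' : (stagesBelow k).obj Y ≅ (stagesBelow k).obj Z) :
    F.diagIso (e ≪≫ e') = F.diagIso e ≪≫ F.diagIso e' :=
  Iso.ext (F.map_comp _ _ _ _)

theorem truncateIso_diagIso {X Y : Tree} {k : ℕ}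
    (e : (stagesBelow (k + 1)).obj X ≅ (stagesBelow (k + 1)).obj Y) :
    truncateIso (F.diagIso e) = F.diagIso (truncateIso e) :=
  Iso.ext (F.map_truncate _ _)

theorem truncateIso_symm_trans_diagIso {X Y Z Z' : Tree} {k : ℕ}
    {c : (stagesBelow k).obj X ≅ (stagesBelow k).obj Y}
    {d : (stagesBelow k).obj X ≅ (stagesBelow k).obj Z}
    {e : (stagesBelow (k + 1)).obj Y ≅ (stagesBelow (k + 1)).obj Z}
    {d' : (stagesBelow (k + 1)).obj ((B.obj (op X)).obj X) ≅ (stagesBelow (k + 1)).obj Z'}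
    {e' : (stagesBelow (k + 2)).obj ((B.obj (op Y)).obj Y) ≅ (stagesBelow (k + 2)).obj Z'}
    (h : c ≪≫ truncateIso e = d) (h' : F.diagIso c ≪≫ truncateIso e' = d') :
    truncateIso (e'.symm ≪≫ F.diagIso e) = d'.symm ≪≫ F.diagIso d := by
  subst h h'
  rw [truncateIso_trans, F.truncateIso_diagIso, F.diagIso_trans, Iso.trans_symm, Iso.trans_assoc,
    Iso.symm_self_id_assoc]
  rfl

/-- The iterates of `X ↦ B(X, X)`, which approximate its fixed point. -/
def approx (B : Treeᵒᵖ ⥤ Tree ⥤ Tree) : ℕ → Tree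
  | 0 => (Functor.const _).obj PUnit
  | k + 1 => (B.obj (op (approx B k))).obj (approx B k)

/-- Consecutive approximations agree at more and more stages. -/
def approxIso : ∀ k, (stagesBelow k).obj (approx B k) ≅ (stagesBelow k).obj (approx B (k + 1))
  | 0 => ⟨default, default, Subsingleton.elim _ _, Subsingleton.elim _ _⟩
  | k + 1 => F.diagIso (approxIso k)

include F

theorem exists_fixedPoint : ∃ (Z : Tree) (z : Z ⟶ (B.obj (op Z)).obj Z), IsIso z := by
  obtain ⟨d, hd⟩ := Gluing.exists_iso_glue F.approxIso
  let e (k : ℕ) := (d (k + 1)).symm ≪≫ F.diagIso (d k)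
  have he (k : ℕ) : truncateIso (e (k + 1)) = e k :=
    F.truncateIso_symm_trans_diagIso (hd k) (hd (k + 1))
  obtain ⟨z, hz, -⟩ := existsUnique_glue (fun k => (e k).hom) fun k => congrArg Iso.hom (he k)
  exact ⟨_, z, isIso_of_stagesBelow z fun k => hz k ▸ inferInstance⟩

theorem nonempty_isTerminal {X : Tree} (T : Endofunctor.Coalgebra (B.obj (op X))) [IsIso T.str] :
    Nonempty (IsTerminal T) := by
  have existsUnique_hom (C : Endofunctor.Coalgebra (B.obj (op X))) :
      ∃! h : C.V ⟶ T.V, C.str ≫ (B.obj (op X)).map h ≫ inv T.str = h := by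
    refine existsUnique_fixedPoint _
      (fun k u => (stagesBelow (k + 1)).map C.str ≫ F.map (𝟙 _) u ≫
        (stagesBelow (k + 1)).map (inv T.str)) (fun k u => ?_) fun k h => ?_
    · simp only [PartialHom.truncate_comp, F.map_truncate]
      rfl
    · rw [← CategoryTheory.Functor.map_id, F.map_stagesBelow]
      simp
  choose h hh h_unique using existsUnique_hom
  have hom_iff (C : Endofunctor.Coalgebra (B.obj (op X))) (f : C.V ⟶ T.V) :
      C.str ≫ (B.obj (op X)).map f = f ≫ T.str ↔
        C.str ≫ (B.obj (op X)).map f ≫ inv T.str = f := by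
    rw [← Category.assoc, IsIso.comp_inv_eq]
  exact ⟨IsTerminal.ofUniqueHom (fun C => ⟨h C, (hom_iff C _).2 (hh C)⟩)
    fun C f => Endofunctor.Coalgebra.Hom.ext (h_unique C _ ((hom_iff C _).1 f.h))⟩

theorem exists_isLocallyFinal :
    ∃ (Z : Tree) (z : Z ⟶ (B.obj (op Z)).obj Z), IsLocallyFinal B Z z := by
  obtain ⟨Z, z, hz⟩ := F.exists_fixedPoint
  exact ⟨Z, z, F.nonempty_isTerminal ⟨Z, z⟩⟩

/-- Fixing the contravariant argument of a locally contractive bifunctor. -/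
def const (X : Tree) : LocalContraction ((Functor.const Treeᵒᵖ).obj (B.obj (op X))) where
  map _ v := F.map (𝟙 _) v
  map_comp _ _ v v' := by rw [← F.map_comp, Category.id_comp]
  map_truncate _ v := F.map_truncate _ v
  map_stagesBelow k _ g := by
    simpa using F.map_stagesBelow k (𝟙 X) g

theorem exists_isTerminal (X : Tree) :
    ∃ T : Endofunctor.Coalgebra (B.obj (op X)), Nonempty (IsTerminal T) := by
  obtain ⟨Z, z, hz⟩ := (F.const X).exists_isLocallyFinal
  exact ⟨⟨Z, z⟩, hz⟩

end LocalContraction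

section BehaviourContraction

variable {X X' Y Y' : Tree} {k : ℕ}

namespace PartialHom

/-- The later modality on partial morphisms. -/
def mapLater (u : PartialHom k X Y) : PartialHom (k + 1) (later.obj X) (later.obj Y) :=
  ofMaps
    (fun
      | 0, _, _ => PUnit.unit
      | n + 1, hn, x => u.stage n (Nat.lt_of_succ_lt_succ hn) x)
    (by
      rintro (_ | m) (_ | n) h hn x
      · rfl
      · rfl
      · omega
      · exact u.stage_res (Nat.le_of_succ_le_succ h) (Nat.lt_of_succ_lt_succ hn) x)

theorem mapLater_comp {Z : Tree} (u : PartialHom k X Y) (v : PartialHom k Y Z) :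
    mapLater (u ≫ v) = u.mapLater ≫ v.mapLater :=
  PartialHom.ext (by rintro (_ | n) _ _ <;> rfl)

theorem truncate_mapLater (u : PartialHom (k + 1) X Y) :
    truncate u.mapLater = mapLater u.truncate :=
  PartialHom.ext (by rintro (_ | n) _ _ <;> rfl)

theorem mapLater_stagesBelow (k : ℕ) (f : X ⟶ Y) :
    mapLater ((stagesBelow k).map f) = (stagesBelow (k + 1)).map (later.map f) :=
  PartialHom.ext (by rintro (_ | n) _ _ <;> rfl)

end PartialHom

/-- The action of partial morphisms on the exponential. -/
def Exp.mapBelow (u : PartialHom k X' X) (v : PartialHom k Y Y') {n : ℕ} (hn : n < k)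
    (f : Exp X Y n) : Exp X' Y' n where
  app i hi x := v.stage i (hi.trans_lt hn) (f.app i hi (u.stage i (hi.trans_lt hn) x))
  nat hji hi x := by rw [← v.stage_res hji, f.nat, u.stage_res hji]

/-- The action of partial morphisms on `𝒫_ω Y + Y^X`. -/
def mapBehaviour (u : PartialHom k X' X) (v : PartialHom k Y Y') :
    PartialHom k (sumT (powF.obj Y) ((expF.obj (op X)).obj Y))
      (sumT (powF.obj Y') ((expF.obj (op X')).obj Y')) :=
  .ofMaps (fun n hn => Sum.map (Pow.map (v.stage n hn)) (Exp.mapBelow u v hn))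
    (by
      rintro m n h hn (U | f)
      · exact congrArg Sum.inl (Pow.map_square (v.stage_res h hn) U)
      · rfl)

/-- `B` is locally contractive because its arguments occur only under `▷`. -/
def bncContraction : LocalContraction Bnc where
  map u v := mapBehaviour u.mapLater v.mapLater
  map_comp u u' v v' := by
    rw [PartialHom.mapLater_comp, PartialHom.mapLater_comp]
    refine PartialHom.ext fun n hn b => ?_
    rcases b with U | f
    · exact congrArg Sum.inl
        (Pow.map_triangle (f := v.mapLater.stage n hn) (g := v'.mapLater.stage n hn)
          (fun _ => rfl) U).symm
    · rfl
  map_truncate u v := by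
    rw [← PartialHom.truncate_mapLater, ← PartialHom.truncate_mapLater]
    rfl
  map_stagesBelow k f g := by
    rw [PartialHom.mapLater_stagesBelow, PartialHom.mapLater_stagesBelow]
    refine PartialHom.ext fun n hn b => ?_
    rcases b with U | f <;> rfl

end BehaviourContraction

/-! ## Existence of denotational models -/

/-- The evaluation of terms in an algebra whose structure is only defined below stage `k`. -/
def evalBelow {A : Tree} {k : ℕ} (a : PartialHom k (sigF.obj A) A) :
    PartialHom k (termF.obj A) A :=
  .ofMaps (fun n hn => Term.fold id (a.stage n hn)) fun {m n} h hn t =>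
    (Term.comp_fold (fun v => Term.var (res A h v)) Term.mk (a.stage m (h.trans_lt hn))
      (Term.fold id (a.stage m (h.trans_lt hn))) (fun s => Term.fold_mk _ _ s) t).trans
    (Term.comp_fold id (a.stage n hn) (a.stage m (h.trans_lt hn)) (res A h)
      (fun s => (a.stage_res h hn s).symm) t).symm

theorem IsLocallyFinal.isIso {C : Type*} [Category* C] {B : Cᵒᵖ ⥤ C ⥤ C} {Z : C}
    {z : Z ⟶ (B.obj (op Z)).obj Z} (hz : IsLocallyFinal B Z z) : IsIso z :=
  Endofunctor.Coalgebra.Terminal.str_isIso hz.some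

/-- The bialgebra law is a guarded equation for the algebra structure: `B(Z, -)` hides the last
stage of the structure that occurs on its right-hand side. -/
theorem HOGSOSLaw.existsUnique_isBialgebra {B : Treeᵒᵖ ⥤ Tree ⥤ Tree} (ρ : HOGSOSLaw B)
    (F : LocalContraction B) {Z : Tree} (z : Z ⟶ (B.obj (op Z)).obj Z) [IsIso z] :
    ∃! a : sigF.obj Z ⟶ Z, ρ.IsBialgebra Z a z := by
  let r := sigF.map (FunctorToTypes.prod.lift (𝟙 Z) z) ≫ ρ.app Z Z
  have isBialgebra_iff (a : sigF.obj Z ⟶ Z) : ρ.IsBialgebra Z a z ↔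
      r ≫ (B.obj (op Z)).map (termF.map (codiag Z) ≫ evalT a) ≫ inv z = a := by
    rw [← Category.assoc, IsIso.comp_inv_eq, eq_comm, Category.assoc]
    rfl
  simp only [isBialgebra_iff]
  refine existsUnique_fixedPoint _
    (fun k u => (stagesBelow (k + 1)).map r ≫
      F.map (𝟙 _) ((stagesBelow k).map (termF.map (codiag Z)) ≫ evalBelow u) ≫
        (stagesBelow (k + 1)).map (inv z)) (fun k u => ?_) fun k a => ?_
  · simp only [PartialHom.truncate_comp, F.map_truncate]
    rfl
  · have h : evalBelow ((stagesBelow k).map a) = (stagesBelow k).map (evalT a) := rfl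
    rw [h, ← Functor.map_comp, ← CategoryTheory.Functor.map_id, F.map_stagesBelow]
    simp

/-! ## Adequacy -/

theorem evalT_naturality {A A' : Tree} {a : sigF.obj A ⟶ A} {a' : sigF.obj A' ⟶ A'} {f : A ⟶ A'}
    (h : a ≫ f = sigF.map f ≫ a') : evalT a ≫ f = termF.map f ≫ evalT a' := by
  refine hom_ext fun n t => ?_
  have h' (s : Sig (A.obj (op n))) : f.app (op n) (a.app (op n) s) =
      a'.app (op n) (s.map (f.app (op n))) :=
    ConcreteCategory.congr_hom (NatTrans.congr_app h (op n)) s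
  exact (Term.comp_fold id (a.app (op n)) (a'.app (op n)) (f.app (op n)) h' t).trans
    (Term.comp_fold (fun v => Term.var (f.app (op n) v)) Term.mk (a'.app (op n))
      (Term.fold id (a'.app (op n))) (fun s => Term.fold_mk _ _ s) t).symm

theorem str_sem {A : Tree} (a : sigF.obj A ⟶ A) : muSig.str ≫ sem a = sigF.map (sem a) ≫ a :=
  (muSigInitial.to ⟨A, a⟩).h.symm

namespace HOGSOSLaw

variable {B : Treeᵒᵖ ⥤ Tree ⥤ Tree} (ρ : HOGSOSLaw B)

/-- The composite `B(id, â ∘ Σ⋆[h, id]) ∘ ρ_{X,Z}` for a `Σ`-algebra `(Z, a)` and `h : X ⟶ Z`. It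
interpolates between `ρ.step` at the domain and at the codomain of `h`. -/
def stepAlong {X Z : Tree} (a : sigF.obj Z ⟶ Z) (h : X ⟶ Z) :
    sigF.obj (prodT X ((B.obj (op X)).obj Z)) ⟶ (B.obj (op X)).obj Z :=
  ρ.app X Z ≫ (B.obj (op X)).map (termF.map (FunctorToTypes.coprod.desc h (𝟙 Z)) ≫ evalT a)

theorem map_stepAlong {A Z : Tree} {a' : sigF.obj A ⟶ A} {a : sigF.obj Z ⟶ Z} {f : A ⟶ Z}
    (h : a' ≫ f = sigF.map f ≫ a) :
    sigF.map (prodMap (𝟙 A) ((B.obj (op A)).map f)) ≫ ρ.stepAlong a f =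
      ρ.step a' ≫ (B.obj (op A)).map f := by
  have codiag_comp : sumMap (𝟙 A) f ≫ FunctorToTypes.coprod.desc f (𝟙 Z) = codiag A ≫ f :=
    hom_ext fun n x => by rcases x with x | x <;> rfl
  rw [stepAlong, step, ← Category.assoc, ρ.natural, Category.assoc, Category.assoc,
    ← Functor.map_comp, ← Functor.map_comp, Category.assoc, evalT_naturality h,
    ← Functor.map_comp_assoc, ← Functor.map_comp_assoc, codiag_comp]

theorem comap_stepAlong {X Z : Tree} (a : sigF.obj Z ⟶ Z) (h : X ⟶ Z) :
    sigF.map (prodMap (𝟙 X) ((B.map h.op).app Z)) ≫ ρ.stepAlong a h =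
      sigF.map (prodMap h (𝟙 ((B.obj (op Z)).obj Z))) ≫ ρ.step a ≫ (B.map h.op).app Z := by
  have desc_eq : FunctorToTypes.coprod.desc h (𝟙 Z) = sumMap h (𝟙 Z) ≫ codiag Z :=
    hom_ext fun n x => by rcases x with x | x <;> rfl
  have dinatural := congrArg (· ≫ (B.obj (op X)).map (termF.map (codiag Z) ≫ evalT a))
    (ρ.dinatural h Z)
  simp only [Category.assoc] at dinatural
  rw [stepAlong, step, desc_eq, Functor.map_comp termF, Category.assoc, Functor.map_comp,
    dinatural, Category.assoc, NatTrans.naturality]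

/-- Both composites solve the primitive recursion with step `ρ.stepAlong a (sem a)`. -/
theorem opModel_map_sem {Z : Tree} {a : sigF.obj Z ⟶ Z} {z : Z ⟶ (B.obj (op Z)).obj Z}
    (hz : ρ.IsBialgebra Z a z) :
    ρ.opModel ≫ (B.obj (op muSig.a)).map (sem a) = sem a ≫ z ≫ (B.map (sem a).op).app Z := by
  refine (primRec_unique (ρ.stepAlong a (sem a)) _ ?_).trans (primRec_unique _ _ ?_).symm
  · calc muSig.str ≫ ρ.opModel ≫ (B.obj (op muSig.a)).map (sem a)
        = sigF.map (FunctorToTypes.prod.lift (𝟙 _) ρ.opModel) ≫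
            ρ.step muSig.str ≫ (B.obj (op muSig.a)).map (sem a) := by
          rw [← Category.assoc, ← Category.assoc]
          exact congrArg (· ≫ _) ρ.opModel_isBialgebra
      _ = _ := by
          rw [← ρ.map_stepAlong (str_sem a), ← Functor.map_comp_assoc]
          rfl
  · calc muSig.str ≫ sem a ≫ z ≫ (B.map (sem a).op).app Z
        = sigF.map (sem a ≫ FunctorToTypes.prod.lift (𝟙 Z) z) ≫
            ρ.step a ≫ (B.map (sem a).op).app Z := by
          rw [← Category.assoc, str_sem, Category.assoc, Functor.map_comp, Category.assoc]
          exact congrArg (sigF.map (sem a) ≫ · ≫ _) hz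
      _ = sigF.map (FunctorToTypes.prod.lift (𝟙 _) (sem a ≫ z)) ≫
            sigF.map (prodMap (sem a) (𝟙 _)) ≫ ρ.step a ≫ (B.map (sem a).op).app Z := by
          rw [← Functor.map_comp_assoc]
          rfl
      _ = _ := by
          rw [← ρ.comap_stepAlong, ← Functor.map_comp_assoc]
          rfl

theorem IsBialgebra.isAdequate {ρ : HOGSOSLaw B} {Z : Tree} {a : sigF.obj Z ⟶ Z}
    {z : Z ⟶ (B.obj (op Z)).obj Z} (hz : ρ.IsBialgebra Z a z) : ρ.IsAdequate Z a := by
  intro T hT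
  let C : Endofunctor.Coalgebra (B.obj (op muSig.a)) := ⟨Z, z ≫ (B.map (sem a).op).app Z⟩
  let f : ρ.opCoalg ⟶ C := ⟨sem a, ρ.opModel_map_sem hz⟩
  exact ⟨(hT.from C).f, congrArg Endofunctor.Coalgebra.Hom.f
    (hT.hom_ext (f ≫ hT.from C) (hT.from ρ.opCoalg))⟩

theorem IsAdequate.behEquiv {ρ : HOGSOSLaw B} {A : Tree} {a : sigF.obj A ⟶ A}
    (h : ρ.IsAdequate A a) {n : ℕ} {p q : Prog}
    (hpq : (sem a).app (op n) p = (sem a).app (op n) q) : ρ.BehEquiv n p q := by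
  intro T hT
  obtain ⟨e, he⟩ := h T hT
  rw [← he]
  exact congrArg (e.app (op n)) hpq

end HOGSOSLaw

/-! ## The operational model of xNCCL -/

/-- What a program does in one step: it either reduces, to finitely many programs, or acts on its
argument as a function. -/
abbrev Action : Type := Pow Prog ⊕ (Prog → Prog)

/-- The action of `p q`, given the action of `p`. -/
def Action.app (a : Action) (q : Prog) : Action :=
  match a with
  | .inl U => .inl (U.map (.app · q))
  | .inr g => .inl (.single (g q))

/-- The action of `p ∥ q`, given the actions of `p` and `q`. -/
def Action.par (p : Prog) (a : Action) (q : Prog) (b : Action) : Action :=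
  match a, b with
  | .inl U, .inl V => .inl (.map₂ .par U V)
  | .inr _, .inl V => .inl (V.map (.par p))
  | .inl U, .inr _ => .inl (U.map (.par · q))
  | .inr _, .inr _ => .inr fun t => .par (.app p t) (.app q t)

/-- The action of a program: the transition relations, read as a function of the program. -/
def action : Prog → Action
  | .var v => v.elim
  | .S => .inr .S₁
  | .K => .inr .K₁
  | .I => .inr id
  | .S₁ p => .inr (.S₂ p)
  | .K₁ p => .inr fun _ => p
  | .S₂ p q => .inr fun t => .app (.app p t) (.app q t)
  | .app p q => (action p).app q
  | .choice p q => .inl (.pair p q)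
  | .par p q => .par p (action p) q (action q)

theorem lab_of_action_eq_inr {p : Prog} {g : Prog → Prog} (hg : action p = .inr g) (t : Prog) :
    Lab p t (g t) := by
  induction p generalizing g with
  | var v => exact v.elim
  | app p q =>
    rw [action] at hg
    cases h : action p <;> rw [h] at hg <;> cases hg
  | choice p q => cases hg
  | par p q ihp ihq =>
    rw [action] at hg
    cases hp : action p <;> cases hq : action q <;> rw [hp, hq] at hg <;> cases hg
    exact .par t (ihp hp) (ihq hq)
  | _ =>
    cases hg
    constructor

theorem lab_iff {p t p' : Prog} : Lab p t p' ↔ ∃ g, action p = .inr g ∧ p' = g t := by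
  refine ⟨fun hl => ?_, fun ⟨g, hg, hp'⟩ => hp' ▸ lab_of_action_eq_inr hg t⟩
  induction hl with
  | par t _ _ ihp ihq =>
    obtain ⟨f, hf, -⟩ := ihp
    obtain ⟨g, hg, -⟩ := ihq
    exact ⟨_, congrArg₂ (Action.par _ · _ ·) hf hg, rfl⟩
  | _ => exact ⟨_, rfl, rfl⟩

theorem red_of_mem_action {p p' : Prog} {U : Pow Prog} (hU : action p = .inl U)
    (hp' : p' ∈ U.1) : Red p p' := by
  induction p generalizing p' U with
  | var v => exact v.elim
  | app p q ih =>
    rw [action] at hU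
    cases h : action p <;> rw [h] at hU <;> cases hU
    · obtain ⟨r, hr, rfl⟩ := hp'
      exact .app_red q (ih h hr)
    · exact .app_lab (lab_iff.2 ⟨_, h, hp'⟩)
  | choice p q =>
    cases hU
    obtain rfl | rfl := hp'
    exacts [.choice_left _ _, .choice_right _ _]
  | par p q ihp ihq =>
    rw [action] at hU
    cases hp : action p <;> cases hq : action q <;> rw [hp, hq] at hU <;> cases hU
    · obtain ⟨r, hr, s, hs, rfl⟩ := hp'
      exact .par_red (ihp hp hr) (ihq hq hs)
    · obtain ⟨r, hr, rfl⟩ := hp'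
      exact .par_left (ihp hp hr) (lab_of_action_eq_inr hq q)
    · obtain ⟨s, hs, rfl⟩ := hp'
      exact .par_right (lab_of_action_eq_inr hp p) (ihq hq hs)
  | _ => cases hU

theorem red_iff {p p' : Prog} : Red p p' ↔ ∃ U, action p = .inl U ∧ p' ∈ U.1 := by
  refine ⟨fun hr => ?_, fun ⟨U, hU, hp'⟩ => red_of_mem_action hU hp'⟩
  induction hr with
  | app_red q _ ih =>
    obtain ⟨U, hU, hp⟩ := ih
    exact ⟨_, congrArg (Action.app · q) hU, _, hp, rfl⟩
  | app_lab hl =>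
    obtain ⟨g, hg, rfl⟩ := lab_iff.1 hl
    exact ⟨_, congrArg (Action.app · _) hg, rfl⟩
  | choice_left p q => exact ⟨_, rfl, .inl rfl⟩
  | choice_right p q => exact ⟨_, rfl, .inr rfl⟩
  | par_red _ _ ihp ihq =>
    obtain ⟨U, hU, hp⟩ := ihp
    obtain ⟨V, hV, hq⟩ := ihq
    exact ⟨_, congrArg₂ (Action.par _ · _ ·) hU hV, _, hp, _, hq, rfl⟩
  | par_right hl _ ih =>
    obtain ⟨g, hg, -⟩ := lab_iff.1 hl
    obtain ⟨V, hV, hq⟩ := ih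
    exact ⟨_, congrArg₂ (Action.par _ · _ ·) hg hV, _, hq, rfl⟩
  | par_left _ hl ih =>
    obtain ⟨g, hg, -⟩ := lab_iff.1 hl
    obtain ⟨U, hU, hp⟩ := ih
    exact ⟨_, congrArg₂ (Action.par _ · _ ·) hU hg, _, hp, rfl⟩

theorem nonempty_of_action_eq_inl {p : Prog} {U : Pow Prog} (hU : action p = .inl U) :
    U.1.Nonempty := by
  induction p generalizing U with
  | var v => exact v.elim
  | app p q ih =>
    rw [action] at hU
    cases h : action p <;> rw [h] at hU <;> cases hU
    exacts [(ih h).image _, Set.singleton_nonempty _]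
  | choice p q =>
    cases hU
    exact Set.insert_nonempty _ _
  | par p q ihp ihq =>
    rw [action] at hU
    cases hp : action p <;> cases hq : action q <;> rw [hp, hq] at hU <;> cases hU
    exacts [(ihp hp).image2 (ihq hq), (ihp hp).image _, (ihq hq).image _]
  | _ => cases hU

/-- Stage `n` of the behaviour `B(μΣ, μΣ)` over programs. -/
abbrev ProgBehaviour (n : ℕ) : Type :=
  Pow (LaterObj muSig.a n) ⊕ Exp (later.obj muSig.a) (later.obj muSig.a) n

/-- The element of `B(μΣ, μΣ)` that an action stands for, at stage `n`. -/
def Action.stage (n : ℕ) : Action → ProgBehaviour n :=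
  Sum.map (Pow.map (next muSig.a n)) fun g => lam (fun _ _ t => g t) fun _ _ _ => rfl

/-- The evaluation of the terms over programs that the law produces. -/
def evalMu : termF.obj (sumT muSig.a muSig.a) ⟶ muSig.a :=
  termF.map (codiag muSig.a) ≫ evalT muSig.str

/-- Stage `n` of `B(id, ι̂ ∘ Σ⋆∇) ∘ ρ`, the map that computes the operational model of a program
from those of its subprograms. -/
def opStep (n : ℕ) (s : Sig (Prog × ProgBehaviour n)) : ProgBehaviour n :=
  Sum.map (Pow.map (laterApp evalMu n)) (Exp.map (𝟙 _) (later.map evalMu))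
    (rhoFun muSig.a muSig.a n s)

/-- Stage `n` of the operational model. -/
def opStage (n : ℕ) (p : Prog) : ProgBehaviour n := rhoNc.opModel.app (op n) p

theorem opStage_mk (n : ℕ) (s : Sig Prog) :
    opStage n (Term.mk s) = opStep n (s.map fun p => (p, opStage n p)) := by
  refine (ConcreteCategory.congr_hom
    (NatTrans.congr_app rhoNc.opModel_isBialgebra (op n)) s).trans ?_
  cases s <;> rfl

theorem expLater_ext {X Y : Tree} {n : ℕ} {f g : Exp (later.obj X) (later.obj Y) n}
    (h : ∀ j (hj : j < n) t, f.app (j + 1) hj t = g.app (j + 1) hj t) : f = g := by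
  ext i hi t
  obtain _ | j := i
  exacts [rfl, h j hi t]

theorem opStep_app (n : ℕ) (p q : Prog) (a : Action) (b : ProgBehaviour n) :
    opStep n (.app (p, a.stage n) (q, b)) = (a.app q).stage n := by
  obtain U | g := a <;> refine congrArg Sum.inl ?_
  · refine (congrArg _ (Pow.map_triangle (fun _ => rfl) U)).trans (Pow.map_square (fun u => ?_) U)
    cases n <;> rfl
  · refine (Pow.map_single _ _).trans (Eq.trans ?_ (Pow.map_single _ _).symm)
    cases n <;> rfl

theorem opStep_choice (n : ℕ) (p q : Prog) (a b : ProgBehaviour n) :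
    opStep n (.choice (p, a) (q, b)) = Action.stage n (.inl (.pair p q)) := by
  refine congrArg Sum.inl ((Pow.map_pair _ _ _).trans (Eq.trans ?_ (Pow.map_pair _ _ _).symm))
  cases n <;> rfl

theorem opStep_par (n : ℕ) (p q : Prog) (a b : Action) :
    opStep n (.par (p, a.stage n) (q, b.stage n)) = (Action.par p a q b).stage n := by
  obtain U | _ := a <;> obtain V | _ := b
  · refine congrArg Sum.inl ?_
    refine (Pow.map₂_triangle (fun _ _ => rfl) _ _).trans (Pow.map₂_square (fun u v => ?_) U V)
    cases n <;> rfl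
  · refine congrArg Sum.inl
      ((congrArg _ (Pow.map_triangle (fun _ => rfl) U)).trans (Pow.map_square (fun u => ?_) U))
    cases n <;> rfl
  · refine congrArg Sum.inl
      ((congrArg _ (Pow.map_triangle (fun _ => rfl) V)).trans (Pow.map_square (fun v => ?_) V))
    cases n <;> rfl
  · exact congrArg Sum.inr (expLater_ext fun _ _ _ => rfl)

theorem opStage_eq_stage_action (n : ℕ) (p : Prog) : opStage n p = (action p).stage n := by
  induction p with
  | var v => exact v.elim
  | S => exact (opStage_mk n .S).trans (congrArg Sum.inr (expLater_ext fun _ _ _ => rfl))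
  | K => exact (opStage_mk n .K).trans (congrArg Sum.inr (expLater_ext fun _ _ _ => rfl))
  | I => exact (opStage_mk n .I).trans (congrArg Sum.inr (expLater_ext fun _ _ _ => rfl))
  | S₁ p => exact (opStage_mk n (.S₁ p)).trans (congrArg Sum.inr (expLater_ext fun _ _ _ => rfl))
  | K₁ p => exact (opStage_mk n (.K₁ p)).trans (congrArg Sum.inr (expLater_ext fun _ _ _ => rfl))
  | S₂ p q =>
    exact (opStage_mk n (.S₂ p q)).trans (congrArg Sum.inr (expLater_ext fun _ _ _ => rfl))
  | app p q ih =>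
    refine (opStage_mk n (.app p q)).trans (Eq.trans ?_ (opStep_app n p q (action p) (opStage n q)))
    exact congrArg (fun a => opStep n (.app (p, a) (q, opStage n q))) ih
  | choice p q => exact (opStage_mk n (.choice p q)).trans (opStep_choice n p q _ _)
  | par p q ihp ihq =>
    refine (opStage_mk n (.par p q)).trans (Eq.trans ?_ (opStep_par n p q (action p) (action q)))
    exact congrArg₂ (fun a b => opStep n (.par (p, a) (q, b))) ihp ihq

/-! ## Behavioural equivalence is step-indexed bisimilarity -/

/-- The Egli–Milner lifting of a relation on programs to actions: a one-step applicative
bisimulation whose successors are related by `R`. -/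
def ActionRel (R : Prog → Prog → Prop) : Action → Action → Prop :=
  Sum.LiftRel (fun U V => (∀ u ∈ U.1, ∃ v ∈ V.1, R u v) ∧ ∀ v ∈ V.1, ∃ u ∈ U.1, R u v)
    fun f g => ∀ t, R (f t) (g t)

theorem ActionRel.mono {R R' : Prog → Prog → Prop} (h : ∀ p q, R p q → R' p q) {a b : Action}
    (hab : ActionRel R a b) : ActionRel R' a b :=
  Sum.LiftRel.mono (fun _ _ hUV =>
      ⟨fun u hu => (hUV.1 u hu).imp fun _ hv => hv.imp_right (h _ _),
        fun v hv => (hUV.2 v hv).imp fun _ hu => hu.imp_right (h _ _)⟩)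
    (fun _ _ hfg t => h _ _ (hfg t)) hab

theorem Pow.map_eq_map_iff {α β : Type} (f : α → β) (U V : Pow α) :
    U.map f = V.map f ↔
      (∀ u ∈ U.1, ∃ v ∈ V.1, f u = f v) ∧ ∀ v ∈ V.1, ∃ u ∈ U.1, f u = f v := by
  simp only [Subtype.ext_iff, Pow.map, Set.Subset.antisymm_iff, Set.image_subset_iff]
  exact and_congr_left' (forall₂_congr fun _ _ =>
    exists_congr fun _ => and_congr_right' eq_comm)

section IsStepBisim

variable {R : ℕ → Prog → Prog → Prop}

theorem IsStepBisim.actionRel (hR : IsStepBisim R) {n : ℕ} {p q : Prog} (h : R (n + 1) p q) :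
    ActionRel (R n) (action p) (action q) := by
  have red_of_rel {p q : Prog} {U V : Pow Prog} (hp : action p = .inl U) (hq : action q = .inl V)
      (h : R (n + 1) p q) : ∀ u ∈ U.1, ∃ v ∈ V.1, R n u v := fun u hu => by
    obtain ⟨v, hv, huv⟩ := hR.red n p q u h (red_of_mem_action hp hu)
    obtain ⟨V, hV, hv⟩ := red_iff.1 hv
    cases hq.symm.trans hV
    exact ⟨v, hv, huv⟩
  have not_rel {p q : Prog} {U : Pow Prog} {g : Prog → Prog} (hp : action p = .inl U)
      (hq : action q = .inr g) : ¬ R (n + 1) p q := fun h => by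
    obtain ⟨u, hu⟩ := nonempty_of_action_eq_inl hp
    obtain ⟨v, hv, -⟩ := hR.red n p q u h (red_of_mem_action hp hu)
    obtain ⟨V, hV, -⟩ := red_iff.1 hv
    cases hq.symm.trans hV
  have symm := (hR.equiv (n + 1)).symm h
  rcases hp : action p with U | f <;> rcases hq : action q with V | g
  · exact .inl ⟨red_of_rel hp hq h, fun v hv => (red_of_rel hq hp symm v hv).imp
      fun _ hu => hu.imp_right (hR.equiv n).symm⟩
  · exact (not_rel hp hq h).elim
  · exact (not_rel hq hp symm).elim
  · refine .inr fun t => ?_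
    obtain ⟨q', hq', hr⟩ := hR.lab n p q t (f t) h (lab_of_action_eq_inr hp t)
    obtain ⟨g', hg', rfl⟩ := lab_iff.1 hq'
    cases hq.symm.trans hg'
    exact hr

theorem isStepBisim_of_actionRel (equiv : ∀ n, Equivalence (R n))
    (mono : ∀ n p q, R (n + 1) p q → R n p q)
    (step : ∀ n p q, R (n + 1) p q → ActionRel (R n) (action p) (action q)) :
    IsStepBisim R where
  equiv := equiv
  mono := mono
  red n p q p' h hr := by
    obtain ⟨U, hU, hp'⟩ := red_iff.1 hr
    have hpq := step n p q h
    rw [hU] at hpq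
    rcases hq : action q with V | g <;> rw [hq] at hpq
    · obtain ⟨q', hq', hr'⟩ := (Sum.liftRel_inl_inl.1 hpq).1 p' hp'
      exact ⟨q', red_of_mem_action hq hq', hr'⟩
    · exact (Sum.not_liftRel_inl_inr hpq).elim
  lab n p q t p' h hl := by
    obtain ⟨f, hf, rfl⟩ := lab_iff.1 hl
    have hpq := step n p q h
    rw [hf] at hpq
    rcases hq : action q with V | g <;> rw [hq] at hpq
    · exact (Sum.not_liftRel_inr_inl hpq).elim
    · exact ⟨g t, lab_of_action_eq_inr hq t, Sum.liftRel_inr_inr.1 hpq t⟩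

end IsStepBisim

section Behaviour

variable {T : Endofunctor.Coalgebra (Bnc.obj (op muSig.a))} (hT : IsTerminal T)

/-- The behaviour of a program, under the later modality. -/
def laterBeh (n : ℕ) (p : Prog) : LaterObj T.V n :=
  laterApp (rhoNc.beh hT) n (next muSig.a n p)

theorem laterBeh_eq_of_le {m n : ℕ} (h : m ≤ n) {p q : Prog}
    (hpq : laterBeh hT n p = laterBeh hT n q) : laterBeh hT m p = laterBeh hT m q := by
  obtain _ | m := m
  · rfl
  obtain _ | n := n
  · omega
  have h : m ≤ n := Nat.le_of_succ_le_succ h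
  exact (app_res (rhoNc.beh hT) h p).trans
    ((congrArg (res T.V h) hpq).trans (app_res (rhoNc.beh hT) h q).symm)

/-- Stage `n` of `B(id, beh)`. -/
def mapBeh (n : ℕ) : ProgBehaviour n →
    Pow (LaterObj T.V n) ⊕ Exp (later.obj muSig.a) (later.obj T.V) n :=
  Sum.map (Pow.map (laterApp (rhoNc.beh hT) n)) (Exp.map (𝟙 _) (later.map (rhoNc.beh hT)))

theorem str_beh (n : ℕ) (p : Prog) :
    T.str.app (op n) ((rhoNc.beh hT).app (op n) p) = mapBeh hT n ((action p).stage n) := by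
  rw [← opStage_eq_stage_action]
  exact (ConcreteCategory.congr_hom
    (NatTrans.congr_app (hT.from rhoNc.opCoalg).h (op n)) p).symm

theorem mapBeh_stage_eq_iff (n : ℕ) (a b : Action) :
    mapBeh hT n (a.stage n) = mapBeh hT n (b.stage n) ↔
      ActionRel (fun p q => laterBeh hT n p = laterBeh hT n q) a b := by
  obtain U | f := a <;> obtain V | g := b
  · have map_stage (U : Pow Prog) : mapBeh hT n (Action.stage n (.inl U)) =
        .inl (U.map (laterBeh hT n)) := congrArg Sum.inl (Pow.map_triangle (fun _ => rfl) U)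
    rw [map_stage, map_stage, Sum.inl.injEq, Pow.map_eq_map_iff, ActionRel, Sum.liftRel_inl_inl]
  · exact iff_of_false Sum.inl_ne_inr Sum.not_liftRel_inl_inr
  · exact iff_of_false Sum.inr_ne_inl Sum.not_liftRel_inr_inl
  · refine Sum.inr_injective.eq_iff.trans (Iff.trans ⟨fun h t => ?_, fun h => ?_⟩
      Sum.liftRel_inr_inr.symm)
    · obtain _ | n := n
      exacts [rfl, congrFun (congrFun (congrFun (congrArg Exp.app h) (n + 1)) le_rfl) t]
    · exact expLater_ext fun j hj t => laterBeh_eq_of_le hT hj (h t)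

theorem beh_eq_iff_actionRel (n : ℕ) (p q : Prog) :
    (rhoNc.beh hT).app (op n) p = (rhoNc.beh hT).app (op n) q ↔
      ActionRel (fun p q => laterBeh hT n p = laterBeh hT n q) (action p) (action q) := by
  have str_injective : Function.Injective (T.str.app (op n)) :=
    have := Endofunctor.Coalgebra.Terminal.str_isIso hT
    ((isIso_iff_bijective (T.str.app (op n))).1 inferInstance).1
  rw [← mapBeh_stage_eq_iff, ← str_beh, ← str_beh]
  exact str_injective.eq_iff.symm

theorem isStepBisim_laterBeh_eq :
    IsStepBisim fun n p q => laterBeh hT n p = laterBeh hT n q :=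
  isStepBisim_of_actionRel (fun _ => ⟨fun _ => rfl, Eq.symm, Eq.trans⟩)
    (fun n _ _ => laterBeh_eq_of_le hT n.le_succ) fun n p q => (beh_eq_iff_actionRel hT n p q).1

theorem IsStepBisim.laterBeh_eq {R : ℕ → Prog → Prog → Prop} (hR : IsStepBisim R) {n : ℕ}
    {p q : Prog} (h : R n p q) : laterBeh hT n p = laterBeh hT n q := by
  induction n generalizing p q with
  | zero => rfl
  | succ n ih =>
    exact (beh_eq_iff_actionRel hT n p q).2 ((hR.actionRel h).mono fun _ _ => ih)

theorem beh_eq_iff_stepBisim (n : ℕ) (p q : Prog) :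
    (rhoNc.beh hT).app (op n) p = (rhoNc.beh hT).app (op n) q ↔ StepBisim (n + 1) p q :=
  ⟨fun h => ⟨_, isStepBisim_laterBeh_eq hT, h⟩, fun ⟨_, hR, h⟩ => hR.laterBeh_eq hT h⟩

end Behaviour

theorem behEquiv_iff_stepBisim (n : ℕ) (p q : Prog) :
    rhoNc.BehEquiv n p q ↔ StepBisim (n + 1) p q := by
  obtain ⟨T, ⟨hT⟩⟩ := bncContraction.exists_isTerminal muSig.a
  exact ⟨fun h => (beh_eq_iff_stepBisim hT n p q).1 (h T hT),
    fun h T hT => (beh_eq_iff_stepBisim hT n p q).2 h⟩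

end XNCCL

theorem mainTheorem8_general :
    (∃ (Z : XNCCL.Tree) (z : Z ⟶ (XNCCL.Bnc.obj (op Z)).obj Z),
      XNCCL.IsLocallyFinal XNCCL.Bnc Z z) ∧
    (∀ X : XNCCL.Tree, ∃ T : Endofunctor.Coalgebra (XNCCL.Bnc.obj (op X)),
      Nonempty (IsTerminal T)) ∧
    (∀ (Z : XNCCL.Tree) (z : Z ⟶ (XNCCL.Bnc.obj (op Z)).obj Z),
      XNCCL.IsLocallyFinal XNCCL.Bnc Z z →
        ∃! a : XNCCL.sigF.obj Z ⟶ Z, XNCCL.rhoNc.IsBialgebra Z a z) ∧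
    (∀ (Z : XNCCL.Tree) (a : XNCCL.sigF.obj Z ⟶ Z) (z : Z ⟶ (XNCCL.Bnc.obj (op Z)).obj Z),
      XNCCL.rhoNc.IsBialgebra Z a z →
        XNCCL.rhoNc.IsAdequate Z a ∧
        ∀ (p q : XNCCL.Prog) (n : ℕ),
          (XNCCL.sem a).app (op n) p = (XNCCL.sem a).app (op n) q →
            XNCCL.rhoNc.BehEquiv n p q ∧ XNCCL.StepBisim n p q) ∧
    (∀ (p q : XNCCL.Prog) (n : ℕ),
      XNCCL.rhoNc.BehEquiv n p q ↔ XNCCL.StepBisim (n + 1) p q) := by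
  refine ⟨XNCCL.bncContraction.exists_isLocallyFinal, XNCCL.bncContraction.exists_isTerminal,
    fun Z z hz => ?_, fun Z a z hz => ⟨hz.isAdequate, fun p q n hpq => ?_⟩,
    fun p q n => XNCCL.behEquiv_iff_stepBisim n p q⟩
  · have := hz.isIso
    exact XNCCL.rhoNc.existsUnique_isBialgebra XNCCL.bncContraction z
  · have behEquiv : XNCCL.rhoNc.BehEquiv n p q := hz.isAdequate.behEquiv hpq
    exact ⟨behEquiv, XNCCL.stepBisim_isGreatest.1.mono n p q
      ((XNCCL.behEquiv_iff_stepBisim n p q).1 behEquiv)⟩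

/-- Denotational model for xNCCL. -/
theorem mainTheorem8 :
    -- the behaviour bifunctor has a locally final coalgebra, and every `B(X, -)` a final one
    (∃ (Z : XNCCL.Tree) (z : Z ⟶ (XNCCL.Bnc.obj (op Z)).obj Z),
      XNCCL.IsLocallyFinal XNCCL.Bnc Z z) ∧
    (∀ X : XNCCL.Tree, ∃ T : Endofunctor.Coalgebra (XNCCL.Bnc.obj (op X)),
      Nonempty (IsTerminal T)) ∧
    -- every locally final coalgebra extends to a denotational model
    (∀ (Z : XNCCL.Tree) (z : Z ⟶ (XNCCL.Bnc.obj (op Z)).obj Z),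
      XNCCL.IsLocallyFinal XNCCL.Bnc Z z →
        ∃ a : XNCCL.sigF.obj Z ⟶ Z, XNCCL.rhoNc.IsDenotationalModel Z a z) ∧
    -- every denotational model is adequate
    (∀ (Z : XNCCL.Tree) (a : XNCCL.sigF.obj Z ⟶ Z) (z : Z ⟶ (XNCCL.Bnc.obj (op Z)).obj Z),
      XNCCL.rhoNc.IsDenotationalModel Z a z →
        XNCCL.rhoNc.IsAdequate Z a ∧
        ∀ (p q : XNCCL.Prog) (n : ℕ),
          (XNCCL.sem a).app (op n) p = (XNCCL.sem a).app (op n) q →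
            XNCCL.rhoNc.BehEquiv n p q ∧ XNCCL.StepBisim n p q) ∧
    -- behavioural equivalence is the explicit bisimilarity, with the index shifted by one
    (∀ (p q : XNCCL.Prog) (n : ℕ),
      XNCCL.rhoNc.BehEquiv n p q ↔ XNCCL.StepBisim (n + 1) p q) := by
  obtain ⟨locallyFinal, final, bialgebra, adequate, bisim⟩ := mainTheorem8_general
  exact ⟨locallyFinal, final, fun Z z hz => (bialgebra Z z hz).exists.imp fun _ ha => ⟨ha, hz⟩,
    fun Z a z h => adequate Z a z h.1, bisim⟩
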